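/- Let $d\ge 1$ be an integer and $m>0$ a real number. Let $f:\mathbb R^d\to\mathbb R$ be $1$-periodic ($f(x+k)=f(x)$ for all $k\in\mathbb Z^d$) and $r$ times continuously differentiable, where $r=m+\tfrac d2+2$ if this number is an integer, and in general $r=\lceil m+\tfrac d2\rceil+2$. Let $c_*=\min_{x\in[0,1]^d}f(x)$, and assume that $f$ has only finitely many minimizers in $[0,1]^d$ and that the Hessian of $f$ is positive definite at each of them. For $k\in\mathbb Z^d$ put $|k|=\sum_j|k_j|$, $e_k(x)=e^{-2\pi i k^\top x}$, $\hat u_k=\int_{[0,1]^d}e_k(x)u(x)\,dx$, and $\|u\|_F=\sum_{k\in\mathbb Z^d}|\hat u_k|\in[0,\infty]$. For $t\in\mathbb N=\{0,1,2,\dots\}$ let $n=n_t=\#\{k\in\mathbb Z^d:|k|\le t\}$ and $\phi_t(x)=(e_k(x))_{|k|\le t}\in\mathbb C^{n}$; for a Hermitian positive semidefinite matrix $A\in\mathbb C^{n\times n}$ let $g_A(x)=\phi_t(x)^*A\,\phi_t(x)$, and let $$\bar c=\bar c_t=\max_{c\in\mathbb R,\ A\in\mathbb C^{n\times n},\ A\succeq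 0}\ c-\|f-c-g_A\|_F .$$ Then this maximum is attained for every $t\in\mathbb N$, and there are constants $C_f$ and $C'$, depending only on $f,m,d$, such that $$0\le c_*-\bar c_t\quad (t\ge 0),\qquad c_*-\bar c_t\le C_f\,t^{-m}\quad (t\ge 1),\qquad c_*-\bar c_t\le C'\,n_t^{-m/d}\quad (t\ge 0).$$ -/

import Mathlib

open scoped ComplexOrder

namespace PeriodicSOS

noncomputable section

/-- The cube `𝒳 = [0,1]^d`. -/
def cube (d : ℕ) : Set (Fin d → ℝ) := Set.Icc 0 1

/-- `f` is `1`-periodic: `f (x + k) = f x` for all `k ∈ ℤ^d`. -/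
def IsPeriodic {d : ℕ} (f : (Fin d → ℝ) → ℝ) : Prop :=
  ∀ (x : Fin d → ℝ) (k : Fin d → ℤ), f (x + fun i => (k i : ℝ)) = f x

/-- The minimum value `c_* = inf_{x ∈ [0,1]^d} f x`. -/
def minValue {d : ℕ} (f : (Fin d → ℝ) → ℝ) : ℝ := sInf (f '' cube d)

/-- The minimizers of `f` in `[0,1]^d`. -/
def minimizers {d : ℕ} (f : (Fin d → ℝ) → ℝ) : Set (Fin d → ℝ) :=
  {x | x ∈ cube d ∧ f x = minValue f}

/-- The Hessian of `f` at `x` is (strictly) positive definite. -/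
def HessianPosDef {d : ℕ} (f : (Fin d → ℝ) → ℝ) (x : Fin d → ℝ) : Prop :=
  ∀ v : Fin d → ℝ, v ≠ 0 → 0 < iteratedFDeriv ℝ 2 f x ![v, v]

/-- The Fourier component `e_k(x) = exp (-2πi kᵀx)`. -/
def fourierMode {d : ℕ} (k : Fin d → ℤ) (x : Fin d → ℝ) : ℂ :=
  Complex.exp (-(2 * Real.pi * Complex.I * ∑ i, (k i : ℂ) * (x i : ℂ)))

/-- The Fourier coefficient `û_k = ∫_{[0,1]^d} e_k(x) u(x) dx`. -/
def fourierCoef {d : ℕ} (u : (Fin d → ℝ) → ℂ) (k : Fin d → ℤ) : ℂ :=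
  ∫ x in cube d, fourierMode k x * u x

/-- The `F` norm `‖u‖_F = ∑_{k ∈ ℤ^d} |û_k|`, with values in `[0,∞]`. -/
def fNorm {d : ℕ} (u : (Fin d → ℝ) → ℂ) : ENNReal :=
  ∑' k : Fin d → ℤ, ‖fourierCoef u k‖ₑ

/-- The frequencies `k ∈ ℤ^d` with `|k| = ∑ j, |k j| ≤ t`. -/
def freqs (d t : ℕ) : Finset (Fin d → ℤ) :=
  (Finset.Icc (fun _ => -(t : ℤ)) (fun _ => (t : ℤ))).filter
    (fun k => ∑ j, |k j| ≤ (t : ℤ))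

theorem mem_freqs {d t : ℕ} {k : Fin d → ℤ} :
    k ∈ freqs d t ↔ ∑ j, |k j| ≤ (t : ℤ) := by
  simp only [freqs, Finset.mem_filter, Finset.mem_Icc, and_iff_right_iff_imp]
  intro h
  have h1 : ∀ j, |k j| ≤ (t : ℤ) := fun j =>
    (Finset.single_le_sum (f := fun j => |k j|) (fun i _ => abs_nonneg _)
      (Finset.mem_univ j)).trans h
  exact ⟨fun j => (abs_le.1 (h1 j)).1, fun j => (abs_le.1 (h1 j)).2⟩

/-- The size `n` of the matrix variable at bandwidth `t`. -/
def matrixSize (d t : ℕ) : ℕ := (freqs d t).card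

/-- The feature map `φ_t : ℝ^d → ℂ^n`, `(φ_t x)_k = e_k(x)` for `|k| ≤ t`. -/
def featureMap {d : ℕ} (t : ℕ) (x : Fin d → ℝ) : freqs d t → ℂ :=
  fun k => fourierMode k.1 x

/-- The model `g_A(x) = φ_t(x)^* A φ_t(x)`; it is real-valued and nonnegative when `A ⪰ 0`. -/
def psdModel {d t : ℕ} (A : Matrix (freqs d t) (freqs d t) ℂ) (x : Fin d → ℝ) : ℂ :=
  star (featureMap t x) ⬝ᵥ A.mulVec (featureMap t x)

/-- The residual `f - c - g_A`. -/
def residual {d t : ℕ} (f : (Fin d → ℝ) → ℝ) (c : ℝ)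
    (A : Matrix (freqs d t) (freqs d t) ℂ) (x : Fin d → ℝ) : ℂ :=
  (f x : ℂ) - (c : ℂ) - psdModel A x

/-- The finite objective values `c - ‖f - c - g_A‖_F` over `c ∈ ℝ` and Hermitian `A ⪰ 0`
(a pair whose residual has infinite `F` norm has objective `-∞` and does not contribute). -/
def sdpValues {d : ℕ} (f : (Fin d → ℝ) → ℝ) (t : ℕ) : Set ℝ :=
  {v | ∃ (c : ℝ) (A : Matrix (freqs d t) (freqs d t) ℂ), A.PosSemidef ∧
    fNorm (residual f c A) ≠ ⊤ ∧ v = c - (fNorm (residual f c A)).toReal}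

/-- The value `c̄` of the relaxed problem at bandwidth `t`. -/
def sdpValue {d : ℕ} (f : (Fin d → ℝ) → ℝ) (t : ℕ) : ℝ := sSup (sdpValues f t)

end

end PeriodicSOS

open MeasureTheory Filter Topology

namespace PeriodicSOS

/-! Upper bound: with absolutely summable coefficients, `|u x| ≤ ‖u‖_F`; applied to the residual at
a minimizer, where `g_A ≥ 0`, this gives `c - ‖f - c - g_A‖_F ≤ c_*`.

Attainment: the zeroth coefficient of `g_A` is `tr A`, so the best `c` for a given `A` is `∫ f - tr
A`. What remains is a continuous function of `A` bounded above by `∫ f - tr A`; since `tr A`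
controls all entries of `A ⪰ 0`, only a compact set of matrices matters.

Rate: put `s = ⌈m + d/2⌉`. The heart is `isPeriodicSOS_sub_minValue`: `f - c_*` is a finite sum of
squares of periodic `C^s` functions `g_j`. Where `f > c_*` a square root suffices. At a minimizer,
Taylor's formula writes `f - c_*` as `Q x (x - x₀) (x - x₀)` with `Q` of class `C^s` and `Q x₀` half
the Hessian; positive definiteness turns this into a local sum of squares (`exists_local_sum_sq`).
Bumps glue the local formulas together (`isPeriodicSOS_of_local`). Truncating each `g_j` to
frequencies `|k| ≤ t` gives `p_j`, and `∑ |p_j|²` is a model `g_A`. Since the `F` norm is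
submultiplicative, the error is at most a constant times the `ℓ¹` Fourier tails of the `g_j`, which
are `O(t^{-m})` by Parseval for order-`s` derivatives and Cauchy–Schwarz on dyadic shells
(`exists_sum_tail_le`). -/

/-- `u` is `ℤ^d`-periodic. -/
def LatticePeriodic {d : ℕ} {E : Type*} (u : (Fin d → ℝ) → E) : Prop :=
  ∀ (x : Fin d → ℝ) (k : Fin d → ℤ), u (x + fun i => (k i : ℝ)) = u x

/-! ### Fourier modes -/

theorem continuous_fourierMode {d : ℕ} (k : Fin d → ℤ) : Continuous (fourierMode k) := by
  unfold fourierMode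
  fun_prop

theorem fourierMode_add {d : ℕ} (k l : Fin d → ℤ) (x : Fin d → ℝ) :
    fourierMode (k + l) x = fourierMode k x * fourierMode l x := by
  simp only [fourierMode, ← Complex.exp_add, Pi.add_apply, Int.cast_add, add_mul,
    Finset.sum_add_distrib]
  ring_nf

theorem fourierMode_zero {d : ℕ} (x : Fin d → ℝ) : fourierMode 0 x = 1 := by
  simp [fourierMode]

theorem star_fourierMode {d : ℕ} (k : Fin d → ℤ) (x : Fin d → ℝ) :
    star (fourierMode k x) = fourierMode (-k) x := by
  have h : (starRingEnd ℂ) (∑ i, (k i : ℂ) * (x i : ℂ)) = ∑ i, (k i : ℂ) * (x i : ℂ) := by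
    rw [map_sum]
    simp
  simp only [fourierMode, Complex.star_def, ← Complex.exp_conj, map_neg, map_mul, h]
  congr 1
  simp [Complex.conj_ofNat]

theorem norm_fourierMode {d : ℕ} (k : Fin d → ℤ) (x : Fin d → ℝ) : ‖fourierMode k x‖ = 1 := by
  have h : -(2 * (Real.pi : ℂ) * Complex.I * ∑ i, (k i : ℂ) * (x i : ℂ)) =
      ((-(2 * Real.pi * ∑ i, (k i : ℝ) * x i) : ℝ) : ℂ) * Complex.I := by
    push_cast
    ring
  rw [fourierMode, h, Complex.norm_exp_ofReal_mul_I]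

/-- The modes `e_k` carry a minus sign in the exponent, so coefficients agree with `mFourierCoeff`
at the same index, while the inversion series runs over `e_{-k}`. -/
theorem mFourier_neg_coe {d : ℕ} (k : Fin d → ℤ) (x : Fin d → ℝ) :
    UnitAddTorus.mFourier (-k) (fun i => (x i : UnitAddCircle)) = fourierMode k x := by
  simp only [UnitAddTorus.mFourier, ContinuousMap.coe_mk, fourier_coe_apply, fourierMode,
    ← Complex.exp_sum, Finset.mul_sum, ← Finset.sum_neg_distrib]
  congr 1
  refine Finset.sum_congr rfl fun i _ => ?_
  simp
  ring

theorem latticePeriodic_fourierMode {d : ℕ} (k : Fin d → ℤ) : LatticePeriodic (fourierMode k) := by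
  intro x l
  rw [← mFourier_neg_coe, ← mFourier_neg_coe]
  congr 1
  ext i
  simp

/-! ### Transfer to the torus -/

attribute [local instance] instMeasureSpaceUnitAddCircle

theorem isProbabilityMeasure_unitAddCircle :
    IsProbabilityMeasure (volume : Measure UnitAddCircle) :=
  inferInstanceAs (IsProbabilityMeasure AddCircle.haarAddCircle)

attribute [local instance] isProbabilityMeasure_unitAddCircle

/-- Gives access to Fourier theory on the torus. Openness matters: a product of open quotient maps
is again a quotient map, so a periodic continuous function descends continuously. -/
theorem exists_torus_lift {d : ℕ} {u : (Fin d → ℝ) → ℂ} (hu : Continuous u)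
    (hp : LatticePeriodic u) :
    ∃ U : C(UnitAddTorus (Fin d), ℂ), ∀ x : Fin d → ℝ,
      U (fun i => (x i : UnitAddCircle)) = u x := by
  have hq : IsOpenQuotientMap
      (Pi.map (fun _ : Fin d => ((↑) : ℝ → UnitAddCircle))) :=
    IsOpenQuotientMap.piMap fun _ => QuotientAddGroup.isOpenQuotientMap_mk
  have hc : ∀ x y, Pi.map (fun _ : Fin d => ((↑) : ℝ → UnitAddCircle)) x =
      Pi.map (fun _ : Fin d => ((↑) : ℝ → UnitAddCircle)) y → u x = u y := by
    intro x y hxy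
    have h : ∀ i, ∃ n : ℤ, y i - x i = n := by
      intro i
      have := congrFun hxy i
      simp only [Pi.map_apply] at this
      rw [eq_comm, ← sub_eq_zero, ← AddCircle.coe_sub, AddCircle.coe_eq_zero_iff] at this
      obtain ⟨n, hn⟩ := this
      exact ⟨n, by simp [← hn]⟩
    choose n hn using h
    have : y = x + fun i => (n i : ℝ) := by
      ext i
      simp [← hn]
    rw [this, hp]
  exact ⟨hq.isQuotientMap.lift (f := ⟨_, hq.continuous⟩) ⟨u, hu⟩ hc, fun x =>
    DFunLike.congr_fun (hq.isQuotientMap.lift_comp (f := ⟨_, hq.continuous⟩) ⟨u, hu⟩ hc) x⟩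

theorem cube_ae_eq (d : ℕ) :
    {x : Fin d → ℝ | ∀ i, x i ∈ Set.Ioc ((0 : Fin d → ℝ) i) ((0 : Fin d → ℝ) i + 1)}
      =ᵐ[volume] cube d := by
  have := Measure.univ_pi_Ioc_ae_eq_Icc (μ := fun _ : Fin d => (volume : Measure ℝ))
    (f := 0) (g := 1)
  have h : {x : Fin d → ℝ | ∀ i, x i ∈ Set.Ioc ((0 : Fin d → ℝ) i) ((0 : Fin d → ℝ) i + 1)} =
      Set.univ.pi fun i => Set.Ioc ((0 : Fin d → ℝ) i) ((1 : Fin d → ℝ) i) := by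
    ext x
    simp
  rw [h]
  exact this

theorem mFourierCoeff_lift {d : ℕ} {u : (Fin d → ℝ) → ℂ} {U : UnitAddTorus (Fin d) → ℂ}
    (h : ∀ x : Fin d → ℝ, U (fun i => (x i : UnitAddCircle)) = u x) (k : Fin d → ℤ) :
    UnitAddTorus.mFourierCoeff U k = fourierCoef u k := by
  rw [UnitAddTorus.mFourierCoeff_eq_integral U k 0, fourierCoef,
    setIntegral_congr_set (cube_ae_eq d)]
  simp only [mFourier_neg_coe, h, smul_eq_mul]

theorem isCompact_cube (d : ℕ) : IsCompact (cube d) := isCompact_Icc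

theorem integrableOn_cube {d : ℕ} {E : Type*} [NormedAddCommGroup E]
    {u : (Fin d → ℝ) → E} (hu : Continuous u) : IntegrableOn u (cube d) :=
  hu.continuousOn.integrableOn_compact (isCompact_cube d)

theorem summable_sq_fourierCoef {d : ℕ} {u : (Fin d → ℝ) → ℂ} (hu : Continuous u)
    (hp : LatticePeriodic u) : Summable fun k => ‖fourierCoef u k‖ ^ 2 := by
  obtain ⟨U, hU⟩ := exists_torus_lift hu hp
  have := (UnitAddTorus.hasSum_sq_mFourierCoeff (ContinuousMap.toLp 2 volume ℂ U)).summable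
  simpa only [UnitAddTorus.mFourierCoeff_toLp, mFourierCoeff_lift hU] using this

theorem hasSum_fourier {d : ℕ} {u : (Fin d → ℝ) → ℂ} (hu : Continuous u)
    (hp : LatticePeriodic u) (hs : Summable (fourierCoef u)) (x : Fin d → ℝ) :
    HasSum (fun k => fourierCoef u k * fourierMode (-k) x) (u x) := by
  obtain ⟨U, hU⟩ := exists_torus_lift hu hp
  have h1 : UnitAddTorus.mFourierCoeff U = fourierCoef u := funext (mFourierCoeff_lift hU)
  have := UnitAddTorus.hasSum_mFourier_series_apply_of_summable (f := U) (by rwa [h1])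
    (fun i => (x i : UnitAddCircle))
  rw [hU, h1] at this
  convert! this using 2 with k
  rw [smul_eq_mul, ← mFourier_neg_coe, neg_neg]

theorem integral_fourierMode {d : ℕ} (k : Fin d → ℤ) :
    ∫ x in cube d, fourierMode k x = if k = 0 then 1 else 0 := by
  have h := orthonormal_iff_ite.1 (UnitAddTorus.orthonormal_mFourier (d := Fin d)) k 0
  rw [ContinuousMap.inner_toLp] at h
  have h2 := mFourierCoeff_lift (d := d) (u := fun _ => 1) (U := fun _ => 1) (fun _ => rfl) k
  rw [UnitAddTorus.mFourierCoeff, fourierCoef] at h2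
  simp only [smul_eq_mul, mul_one] at h2
  rw [← h2, ← h]
  simp [UnitAddTorus.mFourier_zero, UnitAddTorus.mFourier_neg]

/-! ### The `F` norm -/

theorem fourierCoef_add {d : ℕ} {u v : (Fin d → ℝ) → ℂ} (hu : Continuous u) (hv : Continuous v)
    (k : Fin d → ℤ) :
    fourierCoef (fun x => u x + v x) k = fourierCoef u k + fourierCoef v k := by
  simp only [fourierCoef, mul_add]
  exact integral_add (integrableOn_cube ((continuous_fourierMode k).mul hu))
    (integrableOn_cube ((continuous_fourierMode k).mul hv))

theorem fourierCoef_sub {d : ℕ} {u v : (Fin d → ℝ) → ℂ} (hu : Continuous u) (hv : Continuous v)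
    (k : Fin d → ℤ) :
    fourierCoef (fun x => u x - v x) k = fourierCoef u k - fourierCoef v k := by
  simp only [fourierCoef, mul_sub]
  exact integral_sub (integrableOn_cube ((continuous_fourierMode k).mul hu))
    (integrableOn_cube ((continuous_fourierMode k).mul hv))

theorem fourierCoef_sum {d : ℕ} {ι : Type*} (s : Finset ι) {u : ι → (Fin d → ℝ) → ℂ}
    (hu : ∀ i ∈ s, Continuous (u i)) (k : Fin d → ℤ) :
    fourierCoef (fun x => ∑ i ∈ s, u i x) k = ∑ i ∈ s, fourierCoef (u i) k := by
  simp only [fourierCoef, Finset.mul_sum]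
  exact integral_finsetSum _ fun i hi =>
    integrableOn_cube ((continuous_fourierMode k).mul (hu i hi))

theorem fourierCoef_const_mul {d : ℕ} (a : ℂ) (u : (Fin d → ℝ) → ℂ) (k : Fin d → ℤ) :
    fourierCoef (fun x => a * u x) k = a * fourierCoef u k := by
  simp only [fourierCoef, ← integral_const_mul]
  congr 1
  ext x
  ring

theorem fourierCoef_fourierMode {d : ℕ} (l k : Fin d → ℤ) :
    fourierCoef (fourierMode l) k = if k + l = 0 then 1 else 0 := by
  simp only [fourierCoef, ← fourierMode_add, integral_fourierMode]

theorem fourierCoef_const {d : ℕ} (c : ℂ) (k : Fin d → ℤ) :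
    fourierCoef (fun _ => c) k = if k = 0 then c else 0 := by
  have := fourierCoef_const_mul c (fourierMode 0) k
  simp only [fourierMode_zero, mul_one, fourierCoef_fourierMode, add_zero] at this
  rw [this]
  split_ifs <;> simp

theorem summable_of_fNorm_ne_top {d : ℕ} {u : (Fin d → ℝ) → ℂ} (h : fNorm u ≠ ⊤) :
    Summable fun k => ‖fourierCoef u k‖ := by
  have := ENNReal.summable_toReal h
  simpa using this

theorem toReal_fNorm {d : ℕ} (u : (Fin d → ℝ) → ℂ) :
    (fNorm u).toReal = ∑' k, ‖fourierCoef u k‖ := by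
  rw [fNorm, ENNReal.tsum_toReal_eq (fun _ => enorm_ne_top)]
  simp

theorem norm_le_fNorm {d : ℕ} {u : (Fin d → ℝ) → ℂ} (hu : Continuous u)
    (hp : LatticePeriodic u) (h : fNorm u ≠ ⊤) (x : Fin d → ℝ) : ‖u x‖ ≤ (fNorm u).toReal := by
  have hs := summable_of_fNorm_ne_top h
  rw [toReal_fNorm, ← (hasSum_fourier hu hp hs.of_norm x).tsum_eq]
  refine tsum_of_norm_bounded hs.hasSum fun k => ?_
  simp [norm_fourierMode]

theorem fNorm_add_le {d : ℕ} {u v : (Fin d → ℝ) → ℂ} (hu : Continuous u) (hv : Continuous v) :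
    fNorm (fun x => u x + v x) ≤ fNorm u + fNorm v := by
  simp only [fNorm, fourierCoef_add hu hv, ← ENNReal.tsum_add]
  exact ENNReal.tsum_le_tsum fun k => enorm_add_le _ _

theorem fNorm_sum_le {d : ℕ} {ι : Type*} (s : Finset ι) {u : ι → (Fin d → ℝ) → ℂ}
    (hu : ∀ i ∈ s, Continuous (u i)) :
    fNorm (fun x => ∑ i ∈ s, u i x) ≤ ∑ i ∈ s, fNorm (u i) := by
  simp only [fNorm, fourierCoef_sum s hu]
  rw [← Summable.tsum_finsetSum (fun _ _ => ENNReal.summable)]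
  exact ENNReal.tsum_le_tsum fun k => enorm_sum_le _ _

/-- Multiplication by an absolutely convergent trigonometric series is bounded for the `F` norm. -/
theorem fNorm_mul_le {d : ℕ} {ι : Type*} [Countable ι] {u v : (Fin d → ℝ) → ℂ}
    (hu : Continuous u) (a : ι → ℂ) (κ : ι → Fin d → ℤ) (ha : Summable fun i => ‖a i‖)
    (hv : ∀ x, HasSum (fun i => a i * fourierMode (κ i) x) (v x)) :
    fNorm (fun x => u x * v x) ≤ fNorm u * ∑' i, ‖a i‖ₑ := by
  -- Multiplying by a mode shifts the coefficients, so those of the product form a convolution; `∑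
  -- ‖a i‖ < ∞` and `u` integrable on the cube allow sum and integral to be exchanged.
  have hc : ∀ l, fourierCoef (fun x => u x * v x) l = ∑' i, a i * fourierCoef u (l + κ i) := by
    intro l
    have hF : ∀ i, Continuous fun x => a i * (fourierMode (l + κ i) x * u x) := fun i =>
      continuous_const.mul ((continuous_fourierMode _).mul hu)
    have hn : ∀ i x, ‖a i * (fourierMode (l + κ i) x * u x)‖ = ‖a i‖ * ‖u x‖ := by
      intro i x
      simp [norm_fourierMode]
    have := hasSum_integral_of_summable_integral_norm (μ := volume.restrict (cube d))
      (F := fun i x => a i * (fourierMode (l + κ i) x * u x))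
      (fun i => integrableOn_cube (hF i)) (by
        simp only [hn, integral_const_mul]
        exact ha.mul_right _)
    simp only [integral_const_mul] at this
    refine Eq.trans ?_ this.tsum_eq.symm
    rw [fourierCoef]
    congr 1
    ext x
    have h2 := ((hv x).mul_left (fourierMode l x * u x)).tsum_eq
    rw [← mul_assoc, ← h2]
    congr 1
    ext i
    rw [fourierMode_add]
    ring
  calc fNorm (fun x => u x * v x) ≤ ∑' l, ∑' i, ‖a i‖ₑ * ‖fourierCoef u (l + κ i)‖ₑ := by
        refine ENNReal.tsum_le_tsum fun l => ?_
        rw [hc]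
        refine enorm_tsum_le_tsum_enorm.trans (ENNReal.tsum_le_tsum fun i => ?_)
        rw [enorm_mul]
    _ = ∑' i, ‖a i‖ₑ * fNorm u := by
        rw [ENNReal.tsum_comm]
        refine tsum_congr fun i => ?_
        rw [ENNReal.tsum_mul_left, fNorm,
          (Equiv.addRight (κ i)).tsum_eq (fun l => ‖fourierCoef u l‖ₑ) |>.symm]
        rfl
    _ = _ := by rw [ENNReal.tsum_mul_right, mul_comm]

/-! ### Decay of Fourier coefficients -/

theorem LatticePeriodic.fderiv {d : ℕ} {E : Type*} [NormedAddCommGroup E] [NormedSpace ℝ E]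
    {u : (Fin d → ℝ) → E} (hp : LatticePeriodic u) : LatticePeriodic (fderiv ℝ u) := by
  intro x k
  rw [← fderiv_comp_add_right]
  congr 1
  ext y
  exact hp y k

/-- Divergence theorem for the field with `w` in slot `j` and zero elsewhere: the two faces normal
to direction `j` differ by a lattice vector, so they cancel. -/
theorem integral_fderiv_cube {d : ℕ} {w : (Fin d → ℝ) → ℂ} (hw : ContDiff ℝ 1 w)
    (hp : LatticePeriodic w) (j : Fin d) :
    ∫ x in cube d, fderiv ℝ w x (Pi.single j 1) = 0 := by
  obtain _ | n := d
  · exact j.elim0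
  have hc : Continuous fun x => fderiv ℝ w x (Pi.single j 1) :=
    (hw.continuous_fderiv one_ne_zero).clm_apply continuous_const
  have hsum : ∀ x, (∑ i, (if i = j then fderiv ℝ w x else 0) (Pi.single i (1 : ℝ))) =
      fderiv ℝ w x (Pi.single j 1) := by
    intro x
    rw [Finset.sum_eq_single j]
    · simp
    · intro b _ hb
      simp [hb]
    · simp
  have h := integral_divergence_of_hasFDerivAt_off_countable' (E := ℂ) (n := n) 0 1
    zero_le_one (fun i => if i = j then w else 0)
    (fun i x => if i = j then fderiv ℝ w x else 0) ∅ Set.countable_empty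
    (fun i => by
      split_ifs
      · exact hw.continuous.continuousOn
      · exact continuousOn_const)
    (fun x _ i => by
      split_ifs
      · exact (hw.differentiable one_ne_zero x).hasFDerivAt
      · exact hasFDerivAt_const 0 x)
    (by simp only [hsum]; exact integrableOn_cube hc)
  simp only [hsum] at h
  refine h.trans (Finset.sum_eq_zero fun i _ => ?_)
  by_cases hi : i = j
  · subst hi
    simp only [if_true, sub_eq_zero]
    congr 1
    ext y
    rw [← hp (i.insertNth ((0 : Fin (n + 1) → ℝ) i) y) (Pi.single i 1)]
    congr 1
    ext l
    refine Fin.succAboveCases i ?_ (fun l => ?_) l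
    · simp
    · simp
  · simp [hi]

theorem hasFDerivAt_fourierMode {d : ℕ} (k : Fin d → ℤ) (x : Fin d → ℝ) :
    ∃ L : (Fin d → ℝ) →L[ℝ] ℂ, HasFDerivAt (fourierMode k) L x ∧
      ∀ j, L (Pi.single j 1) = -(2 * Real.pi * Complex.I * k j) * fourierMode k x := by
  let ℓ : (Fin d → ℝ) →L[ℝ] ℂ := ∑ i, (-(2 * Real.pi * Complex.I * k i)) •
    (Complex.ofRealCLM.comp (ContinuousLinearMap.proj (R := ℝ) (φ := fun _ : Fin d => ℝ) i))
  have hℓ : ∀ y, ℓ y = -(2 * Real.pi * Complex.I * ∑ i, (k i : ℂ) * (y i : ℂ)) := by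
    intro y
    simp only [ℓ, sum_apply, smul_apply, Finset.mul_sum,
      ← Finset.sum_neg_distrib]
    refine Finset.sum_congr rfl fun i _ => ?_
    simp
    ring
  have h : fourierMode k = fun y => Complex.exp (ℓ y) := by
    ext y
    rw [hℓ, fourierMode]
  refine ⟨Complex.exp (ℓ x) • ℓ, ?_, fun j => ?_⟩
  · rw [h]
    exact ℓ.hasFDerivAt.cexp
  · rw [smul_apply, h, smul_eq_mul, mul_comm]
    congr 1
    rw [hℓ, Finset.sum_eq_single j]
    · simp
    · intro b _ hb
      simp [hb]
    · simp

theorem contDiff_fourierMode {d : ℕ} (k : Fin d → ℤ) {n : WithTop ℕ∞} :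
    ContDiff ℝ n (fourierMode k) := by
  unfold fourierMode
  have h : ∀ i : Fin d, ContDiff ℝ n fun x : Fin d → ℝ => (x i : ℂ) := fun i =>
    Complex.ofRealCLM.contDiff.comp (contDiff_apply ℝ ℝ i)
  exact ((contDiff_const.mul (ContDiff.sum fun i _ => contDiff_const.mul (h i))).neg).cexp

theorem fourierCoef_fderiv {d : ℕ} {u : (Fin d → ℝ) → ℂ} (hu : ContDiff ℝ 1 u)
    (hp : LatticePeriodic u) (j : Fin d) (k : Fin d → ℤ) :
    fourierCoef (fun x => fderiv ℝ u x (Pi.single j 1)) k =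
      2 * Real.pi * Complex.I * k j * fourierCoef u k := by
  have hc : Continuous fun x => fderiv ℝ u x (Pi.single j 1) :=
    (hu.continuous_fderiv one_ne_zero).clm_apply continuous_const
  have h0 := integral_fderiv_cube (w := fun x => fourierMode k x * u x)
    ((contDiff_fourierMode k).mul hu)
    (fun x l => by simp only [latticePeriodic_fourierMode k x l, hp x l]) j
  have h1 : ∀ x, fderiv ℝ (fun x => fourierMode k x * u x) x (Pi.single j 1) =
      fourierMode k x * fderiv ℝ u x (Pi.single j 1) -
        2 * Real.pi * Complex.I * k j * (fourierMode k x * u x) := by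
    intro x
    obtain ⟨L, hL, hL'⟩ := hasFDerivAt_fourierMode k x
    rw [(hL.fun_mul (hu.differentiable one_ne_zero x).hasFDerivAt).fderiv]
    simp only [add_apply, smul_apply, hL', smul_eq_mul]
    ring
  simp only [h1] at h0
  have i1 : Continuous fun x => fourierMode k x * fderiv ℝ u x (Pi.single j 1) :=
    (continuous_fourierMode k).mul hc
  have i2 : Continuous fun x => 2 * Real.pi * Complex.I * k j * (fourierMode k x * u x) :=
    continuous_const.mul ((continuous_fourierMode k).mul hu.continuous)
  rw [integral_sub (integrableOn_cube i1) (integrableOn_cube i2),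
    integral_const_mul, sub_eq_zero] at h0
  exact h0

/-- Here `w` is the `s`-fold partial derivative of `u` in direction `j`; continuity and periodicity
are all that Parseval needs. -/
theorem exists_fourierCoef_eq_pow_mul {d : ℕ} (j : Fin d) (s : ℕ) {u : (Fin d → ℝ) → ℂ}
    (hu : ContDiff ℝ s u) (hp : LatticePeriodic u) :
    ∃ w : (Fin d → ℝ) → ℂ, Continuous w ∧ LatticePeriodic w ∧
      ∀ k, fourierCoef w k = (2 * Real.pi * Complex.I * k j) ^ s * fourierCoef u k := by
  induction s generalizing u with
  | zero => exact ⟨u, hu.continuous, hp, fun k => by simp⟩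
  | succ s ih =>
    have h1 : ContDiff ℝ s fun x => fderiv ℝ u x (Pi.single j 1) :=
      (hu.fderiv_right (m := s) (by norm_cast)).clm_apply contDiff_const
    obtain ⟨w, hw, hwp, h⟩ := ih h1 (fun x k => by simp only [hp.fderiv x k])
    refine ⟨w, hw, hwp, fun k => ?_⟩
    rw [h, fourierCoef_fderiv (hu.of_le (by norm_cast; omega)) hp, pow_succ]
    ring

theorem exists_sum_pow_mul_sq_fourierCoef_le {d : ℕ} {s : ℕ} (hs : 1 ≤ s)
    {u : (Fin d → ℝ) → ℂ} (hu : ContDiff ℝ s u) (hp : LatticePeriodic u) :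
    ∃ M : ℝ, ∀ B : Finset (Fin d → ℤ),
      ∑ k ∈ B, (∑ j, |(k j : ℝ)|) ^ (2 * s) * ‖fourierCoef u k‖ ^ 2 ≤ M := by
  have h1 : ∀ j, ∃ M : ℝ, ∀ B : Finset (Fin d → ℤ),
      ∑ k ∈ B, |(k j : ℝ)| ^ (2 * s) * ‖fourierCoef u k‖ ^ 2 ≤ M := by
    intro j
    obtain ⟨w, hw, hwp, h⟩ := exists_fourierCoef_eq_pow_mul j s hu hp
    refine ⟨∑' k, ‖fourierCoef w k‖ ^ 2, fun B => ?_⟩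
    refine le_trans (Finset.sum_le_sum fun k _ => ?_)
      ((summable_sq_fourierCoef hw hwp).sum_le_tsum B fun k _ => sq_nonneg _)
    rw [h, norm_mul, mul_pow, norm_pow, ← pow_mul, mul_comm s 2]
    refine mul_le_mul_of_nonneg_right (pow_le_pow_left₀ (abs_nonneg _) ?_ _) (sq_nonneg _)
    have : (1 : ℝ) ≤ 2 * Real.pi := by linarith [Real.pi_gt_three]
    simp only [norm_mul, Complex.norm_I, Complex.norm_real, Complex.norm_ofNat, mul_one,
      Complex.norm_intCast, Real.norm_eq_abs, abs_of_pos Real.pi_pos]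
    exact le_mul_of_one_le_left (abs_nonneg _) this
  choose M hM using h1
  refine ⟨(d : ℝ) ^ (2 * s - 1) * ∑ j, M j, fun B => ?_⟩
  calc ∑ k ∈ B, (∑ j, |(k j : ℝ)|) ^ (2 * s) * ‖fourierCoef u k‖ ^ 2
      ≤ ∑ k ∈ B, ((d : ℝ) ^ (2 * s - 1) * ∑ j, |(k j : ℝ)| ^ (2 * s)) *
          ‖fourierCoef u k‖ ^ 2 := by
        refine Finset.sum_le_sum fun k _ => mul_le_mul_of_nonneg_right ?_ (sq_nonneg _)
        have hd : (0 : ℝ) ≤ (d : ℝ) ^ (2 * s - 1) := by positivity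
        have h := pow_sum_div_card_le_sum_pow (s := Finset.univ) (f := fun j => |(k j : ℝ)|)
          (fun _ _ => abs_nonneg _) (2 * s - 1)
        rw [Nat.sub_add_cancel (by omega), Finset.card_univ, Fintype.card_fin] at h
        -- If `d = 0` the constant `d ^ (2s - 1)` vanishes, but so does the left side, an empty sum
        -- to a positive power.
        obtain hd | hd := hd.eq_or_lt
        · have hd0 : d = 0 := by
            have := eq_zero_of_pow_eq_zero hd.symm
            exact_mod_cast this
          subst hd0
          simp [show s ≠ 0 by omega]
        · rwa [div_le_iff₀' hd] at h
    _ = (d : ℝ) ^ (2 * s - 1) *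
          ∑ j, ∑ k ∈ B, |(k j : ℝ)| ^ (2 * s) * ‖fourierCoef u k‖ ^ 2 := by
        rw [Finset.sum_comm, Finset.mul_sum]
        refine Finset.sum_congr rfl fun k _ => ?_
        rw [mul_assoc, Finset.sum_mul]
    _ ≤ _ := by
        gcongr with j
        exact hM j B

/-! ### Counting frequencies and estimating `ℓ¹` tails -/

theorem card_freqs_le (d t : ℕ) : (freqs d t).card ≤ (2 * t + 1) ^ d := by
  refine (Finset.card_filter_le _ _).trans ?_
  rw [Pi.card_Icc]
  simp only [Int.card_Icc, Finset.prod_const, Finset.card_univ, Fintype.card_fin]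
  refine Nat.pow_le_pow_left ?_ d
  omega

theorem mem_freqs_real {d t : ℕ} {k : Fin d → ℤ} :
    k ∈ freqs d t ↔ ∑ j, |(k j : ℝ)| ≤ t := by
  rw [mem_freqs]
  exact_mod_cast Iff.rfl

/-- Weighted square summability with weight `|k|^{2s}`, `s ≥ m + d/2`, gives `ℓ¹` tails of order
`t^{-m}`. -/
theorem exists_sum_tail_le {d s : ℕ} {m : ℝ} (hm : 0 < m) (hs : m + (d : ℝ) / 2 ≤ s)
    {a : (Fin d → ℤ) → ℝ} {M : ℝ}
    (hM : ∀ B : Finset (Fin d → ℤ), ∑ k ∈ B, (∑ j, |(k j : ℝ)|) ^ (2 * s) * a k ^ 2 ≤ M) :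
    ∃ C : ℝ, 0 ≤ C ∧ ∀ t : ℕ, 1 ≤ t → ∀ B : Finset (Fin d → ℤ), (∀ k ∈ B, k ∉ freqs d t) →
      ∑ k ∈ B, a k ≤ C * (t : ℝ) ^ (-m) := by
  have hM0 : 0 ≤ M := by simpa using hM ∅
  -- One dyadic shell `t < |k| ≤ 2t`, by Cauchy–Schwarz: it has at most `(4t + 1)^d ≤ (5t)^d`
  -- points, and the weight is at least `t^{2s}` there, where `2s ≥ 2m + d`.
  have hblock : ∀ t : ℕ, 1 ≤ t → ∀ B : Finset (Fin d → ℤ), (∀ k ∈ B, k ∉ freqs d t) →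
      (∀ k ∈ B, k ∈ freqs d (2 * t)) →
      ∑ k ∈ B, a k ≤ Real.sqrt (5 ^ d * M) * (t : ℝ) ^ (-m) := by
    intro t ht B h1 h2
    have ht0 : (1 : ℝ) ≤ t := by exact_mod_cast ht
    have htp : (0 : ℝ) < t := by linarith
    have hcard : (B.card : ℝ) ≤ 5 ^ d * (t : ℝ) ^ d := by
      have h3 : B.card ≤ (5 * t) ^ d :=
        ((Finset.card_le_card h2).trans (card_freqs_le d (2 * t))).trans
          (Nat.pow_le_pow_left (by omega) d)
      rw [← mul_pow]
      exact_mod_cast h3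
    have hsq : (t : ℝ) ^ (2 * s) * ∑ k ∈ B, a k ^ 2 ≤ M := by
      rw [Finset.mul_sum]
      refine le_trans (Finset.sum_le_sum fun k hk => ?_) (hM B)
      have := h1 k hk
      rw [mem_freqs_real, not_le] at this
      gcongr
    have hpow : (t : ℝ) ^ d ≤ (t : ℝ) ^ (2 * s) * ((t : ℝ) ^ (-m)) ^ 2 := by
      rw [← Real.rpow_natCast, ← Real.rpow_natCast, ← Real.rpow_natCast, ← Real.rpow_mul htp.le,
        ← Real.rpow_add htp]
      refine Real.rpow_le_rpow_of_exponent_le ht0 ?_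
      push_cast
      linarith
    have hfin : (∑ k ∈ B, a k) ^ 2 ≤ (5 ^ d * M) * ((t : ℝ) ^ (-m)) ^ 2 := by
      calc (∑ k ∈ B, a k) ^ 2 ≤ B.card * ∑ k ∈ B, a k ^ 2 := sq_sum_le_card_mul_sum_sq
        _ ≤ (5 ^ d * ((t : ℝ) ^ (2 * s) * ((t : ℝ) ^ (-m)) ^ 2)) * ∑ k ∈ B, a k ^ 2 := by
            refine mul_le_mul_of_nonneg_right (hcard.trans ?_)
              (Finset.sum_nonneg fun k _ => sq_nonneg _)
            gcongr
        _ = (5 ^ d * ((t : ℝ) ^ (-m)) ^ 2) * ((t : ℝ) ^ (2 * s) * ∑ k ∈ B, a k ^ 2) := by ring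
        _ ≤ (5 ^ d * ((t : ℝ) ^ (-m)) ^ 2) * M := by gcongr
        _ = _ := by ring
    refine (Real.le_sqrt_of_sq_le hfin).trans_eq ?_
    rw [Real.sqrt_mul (by positivity), Real.sqrt_sq (by positivity)]
  have hq : (2 : ℝ) ^ (-m) < 1 := Real.rpow_lt_one_of_one_lt_of_neg one_lt_two (by linarith)
  set q : ℝ := (2 : ℝ) ^ (-m)
  set C0 : ℝ := Real.sqrt (5 ^ d * M)
  have hC : 0 ≤ C0 / (1 - q) := div_nonneg (Real.sqrt_nonneg _) (by linarith)
  refine ⟨C0 / (1 - q), hC, ?_⟩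
  -- Induction on the number of shells. The constant `C = C0 / (1 - q)` solves `C = C0 + q C`, as
  -- doubling `t` multiplies the bound by `q = 2^{-m} < 1`.
  have key : ∀ N t : ℕ, 1 ≤ t → ∀ B : Finset (Fin d → ℤ), (∀ k ∈ B, k ∉ freqs d t) →
      (∀ k ∈ B, k ∈ freqs d (2 ^ N * t)) → ∑ k ∈ B, a k ≤ C0 / (1 - q) * (t : ℝ) ^ (-m) := by
    intro N
    induction N with
    | zero =>
      intro t ht B h1 h2
      have : B = ∅ := Finset.eq_empty_of_forall_notMem fun k hk =>
        h1 k hk (by simpa using h2 k hk)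
      rw [this, Finset.sum_empty]
      positivity
    | succ N ih =>
      intro t ht B h1 h2
      rw [← Finset.sum_filter_add_sum_filter_not B (fun k => k ∈ freqs d (2 * t))]
      have e1 := hblock t ht (B.filter fun k => k ∈ freqs d (2 * t))
        (fun k hk => h1 k (Finset.mem_filter.1 hk).1) (fun k hk => (Finset.mem_filter.1 hk).2)
      have e2 := ih (2 * t) (by omega) (B.filter fun k => k ∉ freqs d (2 * t))
        (fun k hk => (Finset.mem_filter.1 hk).2)
        (fun k hk => by
          have := h2 k (Finset.mem_filter.1 hk).1
          rwa [pow_succ, mul_assoc] at this)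
      have e3 : ((2 * t : ℕ) : ℝ) ^ (-m) = q * (t : ℝ) ^ (-m) := by
        push_cast
        rw [Real.mul_rpow (by norm_num) (by positivity)]
      rw [e3] at e2
      have hne : 1 - q ≠ 0 := by linarith
      have e4 : C0 / (1 - q) * (t : ℝ) ^ (-m) =
          C0 * (t : ℝ) ^ (-m) + C0 / (1 - q) * (q * (t : ℝ) ^ (-m)) := by
        field_simp
        ring
      linarith
  intro t ht B hB
  obtain ⟨N, hN⟩ : ∃ N : ℕ, ∀ k ∈ B, ∑ j, |k j| ≤ (N : ℤ) := by
    refine ⟨∑ k ∈ B, (∑ j, |k j|).toNat, fun k hk => ?_⟩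
    have h := Finset.single_le_sum (f := fun k : Fin d → ℤ => (∑ j, |k j|).toNat)
      (fun _ _ => Nat.zero_le _) hk
    omega
  refine key N t ht B hB fun k hk => mem_freqs.2 ((hN k hk).trans ?_)
  have : N ≤ 2 ^ N * t := (Nat.lt_two_pow_self).le.trans (Nat.le_mul_of_pos_right _ ht)
  exact_mod_cast this

theorem exists_fourier_tail_le {d s : ℕ} {m : ℝ} (hm : 0 < m) (hs : m + (d : ℝ) / 2 ≤ s)
    {u : (Fin d → ℝ) → ℂ} (hu : ContDiff ℝ s u) (hp : LatticePeriodic u) :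
    ∃ C : ℝ, 0 ≤ C ∧ ∀ t : ℕ, 1 ≤ t →
      ∑' k : {k // k ∉ freqs d t}, ‖fourierCoef u k‖ₑ ≤ ENNReal.ofReal (C * (t : ℝ) ^ (-m)) := by
  have hs1 : 1 ≤ s := by
    have : (0 : ℝ) < s := by
      have : (0 : ℝ) ≤ d := Nat.cast_nonneg d
      linarith
    exact_mod_cast this
  obtain ⟨M, hM⟩ := exists_sum_pow_mul_sq_fourierCoef_le hs1 hu hp
  obtain ⟨C, hC, h⟩ := exists_sum_tail_le hm hs hM
  refine ⟨C, hC, fun t ht => ?_⟩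
  rw [ENNReal.tsum_eq_iSup_sum]
  refine iSup_le fun B => ?_
  have := h t ht (B.map (Function.Embedding.subtype _)) (by
    intro k hk
    obtain ⟨a, _, rfl⟩ := Finset.mem_map.1 hk
    exact a.2)
  rw [Finset.sum_map] at this
  have e : ∑ k ∈ B, ‖fourierCoef u k‖ₑ = ENNReal.ofReal (∑ k ∈ B, ‖fourierCoef u k‖) := by
    rw [ENNReal.ofReal_sum_of_nonneg fun _ _ => norm_nonneg _]
    simp
  rw [e]
  exact ENNReal.ofReal_le_ofReal this

theorem fNorm_eq_sum_add_tsum {d : ℕ} (u : (Fin d → ℝ) → ℂ) (t : ℕ) :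
    fNorm u = ∑ k ∈ freqs d t, ‖fourierCoef u k‖ₑ +
      ∑' k : {k // k ∉ freqs d t}, ‖fourierCoef u k‖ₑ :=
  (ENNReal.sum_add_tsum_compl (freqs d t) fun k => ‖fourierCoef u k‖ₑ).symm

theorem fNorm_ne_top_of_contDiff {d s : ℕ} {m : ℝ} (hm : 0 < m) (hs : m + (d : ℝ) / 2 ≤ s)
    {u : (Fin d → ℝ) → ℂ} (hu : ContDiff ℝ s u) (hp : LatticePeriodic u) : fNorm u ≠ ⊤ := by
  obtain ⟨C, -, h⟩ := exists_fourier_tail_le hm hs hu hp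
  rw [fNorm_eq_sum_add_tsum u 1]
  refine ENNReal.add_ne_top.2 ⟨?_, ne_top_of_le_ne_top ENNReal.ofReal_ne_top (h 1 le_rfl)⟩
  exact ENNReal.sum_ne_top.2 fun k _ => enorm_ne_top

/-! ### Positive semidefinite matrices -/

open scoped MatrixOrder in
theorem exists_eq_conjTranspose_mul_self {𝕜 n : Type*} [RCLike 𝕜] [Fintype n]
    {A : Matrix n n 𝕜} (hA : A.PosSemidef) : ∃ B : Matrix n n 𝕜, A = B.conjTranspose * B := by
  classical
  exact CStarAlgebra.nonneg_iff_eq_star_mul_self.mp hA.nonneg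

/-- With `A = B* B`, entries are inner products of columns of `B` and the trace is the sum of their
squared norms. This makes trace bounds into compactness. -/
theorem norm_apply_le_trace {n : Type*} [Fintype n] {A : Matrix n n ℂ} (hA : A.PosSemidef)
    (i j : n) : ‖A i j‖ ≤ A.trace.re := by
  obtain ⟨B, rfl⟩ := exists_eq_conjTranspose_mul_self hA
  have hcol : ∀ i, ∑ k, ‖B k i‖ ^ 2 ≤ (B.conjTranspose * B).trace.re := by
    intro i
    have : (B.conjTranspose * B).trace.re = ∑ i, ∑ k, ‖B k i‖ ^ 2 := by
      simp only [Matrix.trace, Matrix.diag_apply, Matrix.mul_apply, Matrix.conjTranspose_apply,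
        Complex.re_sum]
      refine Finset.sum_congr rfl fun i _ => Finset.sum_congr rfl fun k _ => ?_
      rw [Complex.star_def, ← Complex.normSq_eq_conj_mul_self, Complex.ofReal_re,
        Complex.normSq_eq_norm_sq]
    rw [this]
    exact Finset.single_le_sum (f := fun i => ∑ k, ‖B k i‖ ^ 2)
      (fun i _ => Finset.sum_nonneg fun k _ => sq_nonneg _) (Finset.mem_univ i)
  have h1 : ‖(B.conjTranspose * B) i j‖ ≤ ∑ k, (‖B k i‖ ^ 2 + ‖B k j‖ ^ 2) / 2 := by
    rw [Matrix.mul_apply]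
    refine (norm_sum_le _ _).trans (Finset.sum_le_sum fun k _ => ?_)
    rw [norm_mul, Matrix.conjTranspose_apply, norm_star]
    nlinarith [sq_nonneg (‖B k i‖ - ‖B k j‖)]
  rw [← Finset.sum_div, Finset.sum_add_distrib] at h1
  linarith [hcol i, hcol j]

theorem isClosed_posSemidef (n : Type*) [Fintype n] :
    IsClosed {A : Matrix n n ℂ | A.PosSemidef} := by
  simp only [Matrix.posSemidef_iff_dotProduct_mulVec, Set.ofPred_and, Set.ofPred_forall]
  refine IsClosed.inter (isClosed_eq (by fun_prop) continuous_id) (isClosed_iInter fun x => ?_)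
  exact isClosed_le continuous_const (by fun_prop)

theorem isCompact_posSemidef_bounded (n : Type*) [Fintype n] (R : ℝ) :
    IsCompact {A : Matrix n n ℂ | A.PosSemidef ∧ ∀ i j, ‖A i j‖ ≤ R} := by
  have h : IsCompact (Set.univ.pi fun _ : n => Set.univ.pi fun _ : n =>
      Metric.closedBall (0 : ℂ) R) :=
    isCompact_univ_pi fun _ => isCompact_univ_pi fun _ => isCompact_closedBall 0 R
  have h2 : {A : Matrix n n ℂ | A.PosSemidef ∧ ∀ i j, ‖A i j‖ ≤ R} =
      {A : Matrix n n ℂ | A.PosSemidef} ∩ Set.univ.pi fun _ : n => Set.univ.pi fun _ : n =>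
        Metric.closedBall (0 : ℂ) R := by
    ext A
    exact and_congr_right fun _ =>
      ⟨fun h i _ j _ => mem_closedBall_zero_iff.2 (h i j),
        fun h i j => mem_closedBall_zero_iff.1 (h i trivial j trivial)⟩
  rw [h2]
  exact h.inter_left (isClosed_posSemidef n)

/-! ### The model -/

theorem psdModel_eq_sum {d t : ℕ} (A : Matrix (freqs d t) (freqs d t) ℂ) (x : Fin d → ℝ) :
    psdModel A x = ∑ k, ∑ l, A k l * fourierMode (l.1 - k.1) x := by
  simp only [psdModel, dotProduct, Matrix.mulVec, featureMap, Pi.star_apply, star_fourierMode,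
    Finset.mul_sum]
  refine Finset.sum_congr rfl fun k _ => Finset.sum_congr rfl fun l _ => ?_
  rw [sub_eq_add_neg, fourierMode_add]
  ring

theorem continuous_psdModel {d t : ℕ} (A : Matrix (freqs d t) (freqs d t) ℂ) :
    Continuous (psdModel A) := by
  simp only [funext (psdModel_eq_sum A)]
  exact continuous_finsetSum _ fun k _ => continuous_finsetSum _ fun l _ =>
    continuous_const.mul (continuous_fourierMode _)

theorem latticePeriodic_psdModel {d t : ℕ} (A : Matrix (freqs d t) (freqs d t) ℂ) :
    LatticePeriodic (psdModel A) := by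
  intro x k
  simp only [psdModel_eq_sum, latticePeriodic_fourierMode _ x k]

theorem fourierCoef_psdModel {d t : ℕ} (A : Matrix (freqs d t) (freqs d t) ℂ) (q : Fin d → ℤ) :
    fourierCoef (psdModel A) q =
      ∑ k : freqs d t, ∑ l : freqs d t, A k l * (if q + (l.1 - k.1) = 0 then 1 else 0) := by
  have h : ∀ k l : freqs d t, Continuous fun x => A k l * fourierMode (l.1 - k.1) x :=
    fun k l => continuous_const.mul (continuous_fourierMode _)
  rw [show psdModel A = fun x => ∑ k, ∑ l, A k l * fourierMode (l.1 - k.1) x from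
      funext (psdModel_eq_sum A),
    fourierCoef_sum _ fun k _ => continuous_finsetSum _ fun l _ => h k l]
  refine Finset.sum_congr rfl fun k _ => ?_
  rw [fourierCoef_sum _ fun l _ => h k l]
  refine Finset.sum_congr rfl fun l _ => ?_
  rw [fourierCoef_const_mul, fourierCoef_fourierMode]

theorem fourierCoef_psdModel_zero {d t : ℕ} (A : Matrix (freqs d t) (freqs d t) ℂ) :
    fourierCoef (psdModel A) 0 = A.trace := by
  rw [fourierCoef_psdModel, Matrix.trace]
  refine Finset.sum_congr rfl fun k _ => ?_
  rw [Finset.sum_eq_single k]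
  · simp
  · intro l _ hl
    have : l.1 ≠ k.1 := fun h => hl (Subtype.ext h)
    simp [sub_eq_zero, this]
  · simp

theorem fourierCoef_psdModel_eq_zero {d t : ℕ} (A : Matrix (freqs d t) (freqs d t) ℂ)
    {q : Fin d → ℤ} (hq : q ∉ freqs d (2 * t)) : fourierCoef (psdModel A) q = 0 := by
  rw [fourierCoef_psdModel]
  refine Finset.sum_eq_zero fun k _ => Finset.sum_eq_zero fun l _ => ?_
  rw [if_neg, mul_zero]
  intro h
  refine hq (mem_freqs.2 ?_)
  have hqe : q = k.1 - l.1 := by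
    rw [eq_sub_iff_add_eq, ← sub_eq_zero, ← h]
    abel
  have hk := mem_freqs.1 k.2
  have hl := mem_freqs.1 l.2
  calc ∑ j, |q j| ≤ ∑ j, (|k.1 j| + |l.1 j|) := by
        refine Finset.sum_le_sum fun j _ => ?_
        rw [hqe]
        exact abs_sub _ _
    _ ≤ _ := by
        rw [Finset.sum_add_distrib]
        push_cast
        linarith

theorem continuous_fourierCoef_psdModel {d t : ℕ} (q : Fin d → ℤ) :
    Continuous fun A : Matrix (freqs d t) (freqs d t) ℂ => fourierCoef (psdModel A) q := by
  simp only [fourierCoef_psdModel]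
  fun_prop

theorem continuous_residual {d t : ℕ} {f : (Fin d → ℝ) → ℝ} (hf : Continuous f) (c : ℝ)
    (A : Matrix (freqs d t) (freqs d t) ℂ) : Continuous (residual f c A) :=
  ((Complex.continuous_ofReal.comp hf).sub continuous_const).sub (continuous_psdModel A)

theorem latticePeriodic_residual {d t : ℕ} {f : (Fin d → ℝ) → ℝ} (hf : IsPeriodic f) (c : ℝ)
    (A : Matrix (freqs d t) (freqs d t) ℂ) : LatticePeriodic (residual f c A) := by
  intro x k
  simp only [residual, hf x k, latticePeriodic_psdModel A x k]

theorem fourierCoef_residual {d t : ℕ} {f : (Fin d → ℝ) → ℝ} (hf : Continuous f) (c : ℝ)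
    (A : Matrix (freqs d t) (freqs d t) ℂ) (q : Fin d → ℤ) :
    fourierCoef (residual f c A) q =
      fourierCoef (fun x => (f x : ℂ)) q - (if q = 0 then (c : ℂ) else 0) -
        fourierCoef (psdModel A) q := by
  have h : Continuous fun x => (f x : ℂ) := Complex.continuous_ofReal.comp hf
  have h' : Continuous fun x => (f x : ℂ) - c := h.sub continuous_const
  rw [← fourierCoef_const, ← fourierCoef_sub h continuous_const,
    ← fourierCoef_sub h' (continuous_psdModel A)]
  rfl

theorem fourierCoef_ofReal_zero {d : ℕ} (f : (Fin d → ℝ) → ℝ) :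
    fourierCoef (fun x => (f x : ℂ)) 0 = ((∫ x in cube d, f x : ℝ) : ℂ) := by
  simp only [fourierCoef, fourierMode_zero, one_mul]
  exact integral_ofReal

theorem trace_eq_ofReal {n : Type*} [Fintype n] {A : Matrix n n ℂ} (hA : A.PosSemidef) :
    A.trace = (A.trace.re : ℂ) := by
  have := Complex.nonneg_iff.1 hA.trace_nonneg
  exact Complex.ext (by simp) (by simp [← this.2])

theorem zero_mem_freqs (d t : ℕ) : (0 : Fin d → ℤ) ∈ freqs d t := mem_freqs.2 (by simp)

/-- Separates the roles of the variables: `c` enters only the zeroth term, and frequencies beyond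
`2t` are out of reach of the model, so the tail depends on `f` alone. -/
theorem fNorm_residual {d t : ℕ} {f : (Fin d → ℝ) → ℝ} (hf : Continuous f)
    (hF : fNorm (fun x => (f x : ℂ)) ≠ ⊤) (c : ℝ) {A : Matrix (freqs d t) (freqs d t) ℂ}
    (hA : A.PosSemidef) :
    fNorm (residual f c A) ≠ ⊤ ∧ (fNorm (residual f c A)).toReal =
      |(∫ x in cube d, f x) - c - A.trace.re| +
      ∑ q ∈ (freqs d (2 * t)).erase 0,
        ‖fourierCoef (fun x => (f x : ℂ)) q - fourierCoef (psdModel A) q‖ +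
      (∑' q : {q // q ∉ freqs d (2 * t)}, ‖fourierCoef (fun x => (f x : ℂ)) q‖ₑ).toReal := by
  have htail : ∑' q : {q // q ∉ freqs d (2 * t)}, ‖fourierCoef (residual f c A) q‖ₑ =
      ∑' q : {q // q ∉ freqs d (2 * t)}, ‖fourierCoef (fun x => (f x : ℂ)) q‖ₑ := by
    refine tsum_congr fun q => ?_
    have h0 : q.1 ≠ 0 := fun h => q.2 (h ▸ zero_mem_freqs d (2 * t))
    rw [fourierCoef_residual hf, fourierCoef_psdModel_eq_zero A q.2, if_neg h0, sub_zero, sub_zero]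
  have htop : ∑' q : {q // q ∉ freqs d (2 * t)}, ‖fourierCoef (fun x => (f x : ℂ)) q‖ₑ ≠ ⊤ := by
    rw [fNorm_eq_sum_add_tsum _ (2 * t)] at hF
    exact (ENNReal.add_ne_top.1 hF).2
  have hsum : ∑ q ∈ freqs d (2 * t), ‖fourierCoef (residual f c A) q‖ₑ ≠ ⊤ :=
    ENNReal.sum_ne_top.2 fun _ _ => enorm_ne_top
  rw [fNorm_eq_sum_add_tsum _ (2 * t), htail]
  refine ⟨ENNReal.add_ne_top.2 ⟨hsum, htop⟩, ?_⟩
  rw [ENNReal.toReal_add hsum htop, ENNReal.toReal_sum fun _ _ => enorm_ne_top,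
    ← Finset.add_sum_erase _ _ (zero_mem_freqs d (2 * t))]
  simp only [toReal_enorm]
  congr 2
  · rw [fourierCoef_residual hf, fourierCoef_psdModel_zero, trace_eq_ofReal hA,
      fourierCoef_ofReal_zero, if_pos rfl, ← Complex.ofReal_sub, ← Complex.ofReal_sub,
      Complex.norm_real, Real.norm_eq_abs, Complex.ofReal_re]
  · refine Finset.sum_congr rfl fun q hq => ?_
    rw [fourierCoef_residual hf, if_neg (Finset.ne_of_mem_erase hq), sub_zero]

/-! ### Attainment of the maximum -/

theorem exists_isGreatest_sdpValues {d : ℕ} {f : (Fin d → ℝ) → ℝ} (hf : Continuous f)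
    (hF : fNorm (fun x => (f x : ℂ)) ≠ ⊤) (t : ℕ) : ∃ v, IsGreatest (sdpValues f t) v := by
  set I : ℝ := ∫ x in cube d, f x
  set T : ℝ :=
    (∑' q : {q // q ∉ freqs d (2 * t)}, ‖fourierCoef (fun x => (f x : ℂ)) q‖ₑ).toReal
  let S : Matrix (freqs d t) (freqs d t) ℂ → ℝ := fun A => ∑ q ∈ (freqs d (2 * t)).erase 0,
    ‖fourierCoef (fun x => (f x : ℂ)) q - fourierCoef (psdModel A) q‖
  have hS0 : ∀ A, 0 ≤ S A := fun A => Finset.sum_nonneg fun _ _ => norm_nonneg _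
  have hT0 : 0 ≤ T := ENNReal.toReal_nonneg
  let V : Matrix (freqs d t) (freqs d t) ℂ → ℝ := fun A => I - A.trace.re - S A - T
  have hVc : Continuous V := by
    have h1 : Continuous S := continuous_finsetSum _ fun q _ =>
      (continuous_const.sub (continuous_fourierCoef_psdModel q)).norm
    have h2 : Continuous fun A : Matrix (freqs d t) (freqs d t) ℂ => A.trace.re :=
      Complex.continuous_re.comp (by fun_prop)
    exact ((continuous_const.sub h2).sub h1).sub continuous_const
  -- Outside this radius `tr A > I - V 0`, hence `V A < V 0`: nothing there can beat the zero
  -- matrix.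
  set K : Set (Matrix (freqs d t) (freqs d t) ℂ) :=
    {A | A.PosSemidef ∧ ∀ i j, ‖A i j‖ ≤ max 0 (I - V 0)}
  have h0K : (0 : Matrix (freqs d t) (freqs d t) ℂ) ∈ K :=
    ⟨Matrix.PosSemidef.zero, fun i j => by simp⟩
  obtain ⟨A₀, hA₀, hmax⟩ := (isCompact_posSemidef_bounded (freqs d t)
    (max 0 (I - V 0))).exists_isMaxOn ⟨0, h0K⟩ hVc.continuousOn
  have hle : ∀ A : Matrix (freqs d t) (freqs d t) ℂ, A.PosSemidef → V A ≤ V A₀ := by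
    intro A hA
    by_cases hAK : A ∈ K
    · exact hmax hAK
    · have h1 : ∃ i j, max 0 (I - V 0) < ‖A i j‖ := by
        by_contra! h
        exact hAK ⟨hA, h⟩
      obtain ⟨i, j, hij⟩ := h1
      have h2 : I - V 0 < A.trace.re :=
        (le_max_right _ _).trans_lt (hij.trans_le (norm_apply_le_trace hA i j))
      have h3 : V 0 ≤ V A₀ := hmax h0K
      have h4 : V A = I - A.trace.re - S A - T := rfl
      linarith [hS0 A]
  -- This `c` makes the zeroth coefficient of the residual vanish.
  refine ⟨V A₀, ⟨I - A₀.trace.re, A₀, hA₀.1, (fNorm_residual hf hF _ hA₀.1).1, ?_⟩, ?_⟩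
  · rw [(fNorm_residual hf hF _ hA₀.1).2]
    have : I - (I - A₀.trace.re) - A₀.trace.re = 0 := by ring
    rw [this, abs_zero]
    simp only [V, S]
    ring
  · rintro v ⟨c, A, hA, -, rfl⟩
    refine le_trans ?_ (hle A hA)
    rw [(fNorm_residual hf hF c hA).2]
    have := neg_le_abs (I - c - A.trace.re)
    simp only [V, S]
    linarith

theorem le_minValue_of_mem_sdpValues {d : ℕ} {f : (Fin d → ℝ) → ℝ} (hf : Continuous f)
    (hp : IsPeriodic f) {x₀ : Fin d → ℝ} (hx₀ : x₀ ∈ minimizers f) {t : ℕ} {v : ℝ}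
    (hv : v ∈ sdpValues f t) : v ≤ minValue f := by
  obtain ⟨c, A, hA, hfin, rfl⟩ := hv
  have h1 := norm_le_fNorm (continuous_residual hf c A) (latticePeriodic_residual hp c A) hfin x₀
  have h2 := (Complex.abs_re_le_norm _).trans h1
  have h3 : (residual f c A x₀).re = f x₀ - c - (psdModel A x₀).re := by
    simp [residual]
  have h4 : 0 ≤ (psdModel A x₀).re :=
    (Complex.nonneg_iff.1 (hA.dotProduct_mulVec_nonneg (featureMap t x₀))).1
  rw [h3] at h2
  have := (abs_le.1 h2).1
  rw [hx₀.2] at this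
  linarith

/-! ### Truncation of a sum of squares -/

/-- The truncated Fourier series of a sum of squares `h = ∑ g_j²` is a feasible model. -/
theorem exists_posSemidef_fNorm_residual_le {d s : ℕ} {m : ℝ} (hm : 0 < m)
    (hs : m + (d : ℝ) / 2 ≤ s) {ι : Type*} [Fintype ι] {f : (Fin d → ℝ) → ℝ} {c : ℝ}
    {g : ι → (Fin d → ℝ) → ℝ} (hg : ∀ j, ContDiff ℝ s (g j)) (hp : ∀ j, LatticePeriodic (g j))
    (hfg : ∀ x, f x - c = ∑ j, g j x ^ 2) :
    ∃ C : ℝ, 0 ≤ C ∧ ∀ t : ℕ, 1 ≤ t → ∃ A : Matrix (freqs d t) (freqs d t) ℂ, A.PosSemidef ∧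
      fNorm (residual f c A) ≤ ENNReal.ofReal (C * (t : ℝ) ^ (-m)) := by
  let G : ι → (Fin d → ℝ) → ℂ := fun j x => (g j x : ℂ)
  have hG : ∀ j, ContDiff ℝ s (G j) := fun j => Complex.ofRealCLM.contDiff.comp (hg j)
  have hGp : ∀ j, LatticePeriodic (G j) := fun j x k => by simp only [G, hp j x k]
  choose C hC0 hC using fun j => exists_fourier_tail_le hm hs (hG j) (hGp j)
  have hfin : ∀ j, fNorm (G j) ≠ ⊤ := fun j => fNorm_ne_top_of_contDiff hm hs (hG j) (hGp j)
  have hsm : ∀ j, Summable fun k => ‖fourierCoef (G j) k‖ := fun j =>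
    summable_of_fNorm_ne_top (hfin j)
  refine ⟨∑ j, 2 * (fNorm (G j)).toReal * C j, Finset.sum_nonneg fun j _ => by
    have := hC0 j; positivity, fun t ht => ?_⟩
  let v : ι → freqs d t → ℂ := fun j k => fourierCoef (G j) k.1
  refine ⟨∑ j, Matrix.vecMulVec (v j) (star (v j)),
    Matrix.posSemidef_sum _ fun j _ => Matrix.posSemidef_vecMulVec_self_star _, ?_⟩
  let p : ι → (Fin d → ℝ) → ℂ := fun j x => ∑ k : freqs d t, v j k * fourierMode (-k.1) x
  let r : ι → (Fin d → ℝ) → ℂ := fun j x => G j x - p j x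
  have hpc : ∀ j, Continuous (p j) := fun j => continuous_finsetSum _ fun k _ =>
    continuous_const.mul (continuous_fourierMode _)
  have hstarp : ∀ j x, star (p j x) = ∑ k : freqs d t, star (v j k) * fourierMode k.1 x := by
    intro j x
    simp only [p, star_sum, star_mul', star_fourierMode, neg_neg]
  have hmodel : ∀ x, psdModel (∑ j, Matrix.vecMulVec (v j) (star (v j))) x =
      ∑ j, p j x * star (p j x) := by
    intro x
    rw [psdModel, Matrix.sum_mulVec, dotProduct_sum]
    refine Finset.sum_congr rfl fun j _ => ?_
    rw [Matrix.vecMulVec_mulVec, dotProduct_smul, hstarp]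
    simp only [p, dotProduct, featureMap, Pi.star_apply, star_fourierMode]
    rw [MulOpposite.smul_eq_mul_unop, MulOpposite.unop_op]
    congr 1
    exact Finset.sum_congr rfl fun k _ => mul_comm _ _
  -- As `G` is real and `r = G - p`, `G² - |p|² = G·star r + star p·r`: each term contains a tail
  -- factor.
  have hres : residual f c (∑ j, Matrix.vecMulVec (v j) (star (v j))) =
      fun x => ∑ j, (G j x * star (r j x) + star (p j x) * r j x) := by
    ext x
    rw [residual, hmodel, ← Complex.ofReal_sub, hfg, Complex.ofReal_sum, ← Finset.sum_sub_distrib]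
    refine Finset.sum_congr rfl fun j _ => ?_
    have : star (G j x) = G j x := Complex.conj_ofReal _
    simp only [r, star_sub, this, Complex.ofReal_pow]
    simp only [G]
    ring
  have hrsum : ∀ j x, HasSum (fun k : {k // k ∉ freqs d t} =>
      fourierCoef (G j) k * fourierMode (-k.1) x) (r j x) := by
    intro j x
    have h1 := hasSum_fourier (hG j).continuous (hGp j) (hsm j).of_norm x
    have h2 := (Finset.hasSum_compl_iff (f := fun k => fourierCoef (G j) k * fourierMode (-k) x)
      (a := r j x) (freqs d t)).2 (by
        convert! h1 using 1
        simp only [r, p, v]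
        rw [Finset.sum_coe_sort (freqs d t) fun k => fourierCoef (G j) k * fourierMode (-k) x]
        ring)
    exact h2
  have hrstar : ∀ j x, HasSum (fun k : {k // k ∉ freqs d t} =>
      star (fourierCoef (G j) k) * fourierMode k.1 x) (star (r j x)) := by
    intro j x
    have := (hrsum j x).star
    simpa only [star_mul', star_fourierMode, neg_neg] using this
  -- The multiplier bound, applied to the constant `1`, controls `star p` by the sum of the retained
  -- coefficients.
  have hpnorm : ∀ j, fNorm (fun x => star (p j x)) ≤ fNorm (G j) := by
    intro j
    have h1 := fNorm_mul_le (u := fun _ : Fin d → ℝ => (1 : ℂ)) (v := fun x => star (p j x))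
      continuous_const (fun k : freqs d t => star (v j k)) (fun k => k.1) (Summable.of_finite)
      (fun x => by rw [hstarp]; exact hasSum_fintype _)
    have h2 : fNorm (fun _ : Fin d → ℝ => (1 : ℂ)) = 1 := by
      rw [fNorm, tsum_eq_single 0]
      · simp [fourierCoef_const]
      · intro k hk
        simp [fourierCoef_const, hk]
    simp only [one_mul, h2] at h1
    refine h1.trans ?_
    rw [fNorm_eq_sum_add_tsum (G j) t, tsum_fintype,
      ← Finset.sum_coe_sort (freqs d t) fun k => ‖fourierCoef (G j) k‖ₑ]
    refine le_trans (le_of_eq ?_) le_self_add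
    refine Finset.sum_congr rfl fun k _ => ?_
    simp [v, enorm_eq_nnnorm]
  have hrc : ∀ j, Continuous (r j) := fun j => (hG j).continuous.sub (hpc j)
  have hterm : ∀ j, fNorm (fun x => G j x * star (r j x) + star (p j x) * r j x) ≤
      ENNReal.ofReal (2 * (fNorm (G j)).toReal * C j * (t : ℝ) ^ (-m)) := by
    intro j
    set τ := ∑' k : {k // k ∉ freqs d t}, ‖fourierCoef (G j) k‖ₑ
    have e1 : fNorm (fun x => G j x * star (r j x)) ≤ fNorm (G j) * τ := by
      refine (fNorm_mul_le (hG j).continuous _ (fun k : {k // k ∉ freqs d t} => k.1) ?_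
        (hrstar j)).trans_eq ?_
      · simp only [norm_star]
        exact (hsm j).subtype _
      · congr 1
        refine tsum_congr fun k => ?_
        simp [enorm_eq_nnnorm]
    have e2 : fNorm (fun x => star (p j x) * r j x) ≤ fNorm (G j) * τ := by
      refine (fNorm_mul_le (continuous_star.comp (hpc j)) _
        (fun k : {k // k ∉ freqs d t} => -k.1) ((hsm j).subtype _) (hrsum j)).trans ?_
      exact mul_le_mul_left (hpnorm j) τ
    calc _ ≤ fNorm (G j) * τ + fNorm (G j) * τ :=
          (fNorm_add_le ((hG j).continuous.mul (continuous_star.comp (hrc j)))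
            ((continuous_star.comp (hpc j)).mul (hrc j))).trans (add_le_add e1 e2)
      _ = ENNReal.ofReal (2 * (fNorm (G j)).toReal) * τ := by
          rw [ENNReal.ofReal_mul zero_le_two, ENNReal.ofReal_toReal (hfin j), ENNReal.ofReal_ofNat]
          ring
      _ ≤ ENNReal.ofReal (2 * (fNorm (G j)).toReal) * ENNReal.ofReal (C j * (t : ℝ) ^ (-m)) := by
          gcongr
          exact hC j t ht
      _ = _ := by
          rw [← ENNReal.ofReal_mul (by positivity), mul_assoc (2 * _)]
  rw [hres]
  refine (fNorm_sum_le _ fun j _ => ((hG j).continuous.mul (continuous_star.comp (hrc j))).add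
    ((continuous_star.comp (hpc j)).mul (hrc j))).trans ((Finset.sum_le_sum fun j _ =>
      hterm j).trans_eq ?_)
  rw [Finset.sum_mul, ENNReal.ofReal_sum_of_nonneg fun j _ => by
    have := hC0 j
    positivity]

/-! ### Sums of squares of periodic functions -/

/-- `h` is a finite sum of squares of periodic `C^s` functions. -/
def IsPeriodicSOS {d : ℕ} (s : ℕ) (h : (Fin d → ℝ) → ℝ) : Prop :=
  ∃ (ι : Type) (_ : Fintype ι) (g : ι → (Fin d → ℝ) → ℝ),
    (∀ j, ContDiff ℝ s (g j)) ∧ (∀ j, LatticePeriodic (g j)) ∧ ∀ x, h x = ∑ j, g j x ^ 2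

theorem IsPeriodicSOS.sum {d s : ℕ} {κ : Type} [Fintype κ] {h : κ → (Fin d → ℝ) → ℝ}
    (H : ∀ i, IsPeriodicSOS s (h i)) : IsPeriodicSOS s fun x => ∑ i, h i x := by
  choose ι hι g hg hp hsum using H
  refine ⟨Σ i, ι i, inferInstance, fun j => g j.1 j.2, fun j => hg _ _, fun j => hp _ _,
    fun x => ?_⟩
  rw [Fintype.sum_sigma]
  exact Finset.sum_congr rfl fun i _ => hsum i x

theorem IsPeriodicSOS.sq_mul {d s : ℕ} {h a : (Fin d → ℝ) → ℝ} (H : IsPeriodicSOS s h)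
    (ha : ContDiff ℝ s a) (hap : LatticePeriodic a) : IsPeriodicSOS s fun x => a x ^ 2 * h x := by
  obtain ⟨ι, hι, g, hg, hp, hsum⟩ := H
  refine ⟨ι, hι, fun j x => a x * g j x, fun j => ha.mul (hg j),
    fun j x k => by simp only [hap x k, hp j x k], fun x => ?_⟩
  simp only [hsum, Finset.mul_sum, mul_pow]

theorem LatticePeriodic.exists_mem_cube {d : ℕ} {E : Type*} {u : (Fin d → ℝ) → E}
    (hu : LatticePeriodic u) (x : Fin d → ℝ) : ∃ y ∈ cube d, u y = u x := by
  refine ⟨fun i => Int.fract (x i), ⟨fun i => Int.fract_nonneg _, fun i =>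
    (Int.fract_lt_one _).le⟩, ?_⟩
  rw [← hu _ fun i => ⌊x i⌋]
  congr 1
  ext i
  exact Int.fract_add_floor (x i)

/-- Finitely many `ψ_i` have no common zero on the cube, so by periodicity `D = ∑ ψ_i²` is positive
everywhere. Then `h = (D^{-1/2})² ∑ ψ_i² h`, and `D^{-1/2}` is as smooth as the `ψ_i`. -/
theorem isPeriodicSOS_of_local {d s : ℕ} {h : (Fin d → ℝ) → ℝ}
    (H : ∀ x₀ ∈ cube d, ∃ ψ : (Fin d → ℝ) → ℝ, ContDiff ℝ s ψ ∧ LatticePeriodic ψ ∧ ψ x₀ ≠ 0 ∧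
      IsPeriodicSOS s fun x => ψ x ^ 2 * h x) : IsPeriodicSOS s h := by
  choose! ψ hψ hψp hψ0 hψs using H
  obtain ⟨T, hT⟩ := (isCompact_cube d).elim_finite_subcover
    (fun x₀ : cube d => {x | ψ x₀ x ≠ 0})
    (fun x₀ => isOpen_ne_fun (hψ x₀ x₀.2).continuous continuous_const)
    (fun x hx => Set.mem_iUnion.2 ⟨⟨x, hx⟩, hψ0 x hx⟩)
  set D : (Fin d → ℝ) → ℝ := fun x => ∑ i : T, ψ i.1 x ^ 2
  have hDp : LatticePeriodic D := fun x k => by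
    simp only [D]
    exact Finset.sum_congr rfl fun i _ => by rw [hψp i.1 i.1.2 x k]
  have hD0 : ∀ x, 0 < D x := by
    intro x
    obtain ⟨y, hy, hyx⟩ := hDp.exists_mem_cube x
    rw [← hyx]
    obtain ⟨i, hi, hyi⟩ := Set.mem_iUnion₂.1 (hT hy)
    exact Finset.sum_pos' (fun _ _ => sq_nonneg _)
      ⟨⟨i, hi⟩, Finset.mem_univ _, by have : ψ i y ≠ 0 := hyi; positivity⟩
  have hDs : ContDiff ℝ s D := ContDiff.sum fun i _ => (hψ i.1 i.1.2).pow 2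
  have h1 : IsPeriodicSOS s fun x => ∑ i : T, ψ i.1 x ^ 2 * h x :=
    IsPeriodicSOS.sum fun i => hψs i.1 i.1.2
  have h2 := h1.sq_mul (a := fun x => (Real.sqrt (D x))⁻¹)
    ((hDs.sqrt fun x => (hD0 x).ne').inv fun x => (Real.sqrt_pos.2 (hD0 x)).ne')
    (fun x k => by simp only [hDp x k])
  convert! h2 using 2 with x
  rw [← Finset.sum_mul, inv_pow, Real.sq_sqrt (hD0 x).le, inv_mul_cancel_left₀ (hD0 x).ne']

/-! ### Periodization -/

/-- The representative of `x` modulo `ℤ^d` that is nearest to `x₀`. -/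
noncomputable def nearestRep {d : ℕ} (x₀ x : Fin d → ℝ) : Fin d → ℝ :=
  fun i => x i - round (x i - x₀ i)

theorem latticePeriodic_nearestRep {d : ℕ} (x₀ : Fin d → ℝ) :
    LatticePeriodic (nearestRep x₀) := by
  intro x k
  ext i
  have : x i + k i - x₀ i = x i - x₀ i + k i := by ring
  simp only [nearestRep, Pi.add_apply, this, round_add_intCast]
  push_cast
  ring

theorem nearestRep_self {d : ℕ} (x₀ : Fin d → ℝ) : nearestRep x₀ x₀ = x₀ := by
  ext i
  simp [nearestRep]

theorem LatticePeriodic.comp_nearestRep {d : ℕ} {E : Type*} {u : (Fin d → ℝ) → E}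
    (hu : LatticePeriodic u) (x₀ x : Fin d → ℝ) : u (nearestRep x₀ x) = u x := by
  rw [← hu _ fun i => round (x i - x₀ i)]
  congr 1
  ext i
  simp [nearestRep]

theorem round_eq_of_abs_sub_lt {y : ℝ} {n : ℤ} (h : |y - n| < 1 / 2) : round y = n := by
  rw [abs_lt] at h
  rw [round_eq, Int.floor_eq_iff]
  constructor <;> linarith [h.1, h.2]

/-- `nearestRep` is locally a translation except where some coordinate of `x - x₀` is a
half-integer; near such points `u` is evaluated outside its support. -/
theorem contDiff_comp_nearestRep {d : ℕ} {n : WithTop ℕ∞} {u : (Fin d → ℝ) → ℝ}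
    {x₀ : Fin d → ℝ} (hu : ContDiff ℝ n u) (h0 : ∀ x, u x ≠ 0 → ∀ i, |x i - x₀ i| ≤ 1 / 4) :
    ContDiff ℝ n fun x => u (nearestRep x₀ x) := by
  rw [contDiff_iff_contDiffAt]
  intro x
  by_cases hx : ∀ i, |x i - x₀ i - round (x i - x₀ i)| < 1 / 2
  · have hev : ∀ᶠ z in 𝓝 x, ∀ i, |z i - x₀ i - round (x i - x₀ i)| < 1 / 2 := by
      rw [eventually_all]
      intro i
      exact ((((continuous_apply i).sub continuous_const).sub continuous_const).abs).continuousAt.eventually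
        (eventually_lt_nhds (hx i))
    have h1 : ContDiff ℝ n fun z : Fin d → ℝ => u (z - fun i => (round (x i - x₀ i) : ℝ)) :=
      hu.comp (contDiff_id.sub contDiff_const)
    refine h1.contDiffAt.congr_of_eventuallyEq ?_
    filter_upwards [hev] with z hz
    congr 1
    ext i
    simp only [nearestRep, Pi.sub_apply, round_eq_of_abs_sub_lt (hz i)]
  · push Not at hx
    obtain ⟨i, hi⟩ := hx
    -- The margin works because `1/4 + 1/8 < 1/2`.
    have hev : ∀ᶠ z in 𝓝 x, |z i - x i| < 1 / 8 := by
      have hc : Continuous fun z : Fin d → ℝ => |z i - x i| := by fun_prop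
      exact hc.continuousAt.eventually (eventually_lt_nhds (by norm_num))
    refine (contDiffAt_const (c := (0 : ℝ))).congr_of_eventuallyEq ?_
    filter_upwards [hev] with z hz
    by_contra hne
    have h1 := h0 _ hne i
    have h2 := round_le (x i - x₀ i) (round (z i - x₀ i))
    have h3 : |x i - x₀ i - round (z i - x₀ i)| ≤
        |nearestRep x₀ z i - x₀ i| + |z i - x i| := by
      have : x i - x₀ i - (round (z i - x₀ i) : ℝ) =
          (nearestRep x₀ z i - x₀ i) - (z i - x i) := by
        simp only [nearestRep]
        ring
      rw [this]
      exact abs_sub _ _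
    linarith

theorem exists_periodic_cutoff {d s : ℕ} {h : (Fin d → ℝ) → ℝ} (hp : LatticePeriodic h)
    {x₀ : Fin d → ℝ} {ι : Type} [Fintype ι] {g : ι → (Fin d → ℝ) → ℝ}
    (hg : ∀ᶠ x in 𝓝 x₀, (∀ a, ContDiffAt ℝ s (g a) x) ∧ h x = ∑ a, g a x ^ 2) :
    ∃ ψ : (Fin d → ℝ) → ℝ, ContDiff ℝ s ψ ∧ LatticePeriodic ψ ∧ ψ x₀ ≠ 0 ∧
      IsPeriodicSOS s fun x => ψ x ^ 2 * h x := by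
  obtain ⟨δ, hδ, hball⟩ := Metric.eventually_nhds_iff_ball.1 hg
  -- Radius `δ / 2` keeps the closed support of the bump inside the ball where the `g a` are smooth;
  -- `1 / 4` permits periodization.
  have hr : 0 < min (δ / 2) (1 / 4) := by positivity
  let b : ContDiffBump x₀ := ⟨min (δ / 2) (1 / 4) / 2, min (δ / 2) (1 / 4), by positivity,
    by linarith⟩
  have hbout : b.rOut = min (δ / 2) (1 / 4) := rfl
  have hsupp : ∀ x, b x ≠ 0 → dist x x₀ < min (δ / 2) (1 / 4) := by
    intro x hx
    have : x ∈ Function.support b := hx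
    rwa [b.support_eq, Metric.mem_ball, hbout] at this
  have hcoord : ∀ x, b x ≠ 0 → ∀ i, |x i - x₀ i| ≤ 1 / 4 := by
    intro x hx i
    rw [← Real.dist_eq]
    exact (dist_le_pi_dist x x₀ i).trans ((hsupp x hx).le.trans (min_le_right _ _))
  have hu : ∀ a, ContDiff ℝ s fun x => b x * g a x := by
    intro a
    rw [contDiff_iff_contDiffAt]
    intro x
    by_cases hx : x ∈ Metric.ball x₀ δ
    · exact b.contDiff.contDiffAt.mul ((hball x hx).1 a)
    · have hx' : x ∉ tsupport b := by
        rw [b.tsupport_eq, Metric.mem_closedBall, hbout, not_le]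
        rw [Metric.mem_ball, not_lt] at hx
        exact (min_le_left _ _).trans_lt (by linarith)
      refine (contDiffAt_const (c := (0 : ℝ))).congr_of_eventuallyEq ?_
      filter_upwards [notMem_tsupport_iff_eventuallyEq.1 hx'] with z hz
      simp [hz]
  refine ⟨fun x => b (nearestRep x₀ x), contDiff_comp_nearestRep b.contDiff hcoord,
    fun x k => by simp only [latticePeriodic_nearestRep x₀ x k], ?_, ι, inferInstance,
    fun a x => b (nearestRep x₀ x) * g a (nearestRep x₀ x), fun a => ?_, fun a x k => ?_,
    fun x => ?_⟩
  · simp only [nearestRep_self]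
    exact (b.pos_of_mem_ball (Metric.mem_ball_self b.rOut_pos)).ne'
  · exact contDiff_comp_nearestRep (hu a) fun x hx => hcoord x (left_ne_zero_of_mul hx)
  · simp only [latticePeriodic_nearestRep x₀ x k]
  · by_cases hx : b (nearestRep x₀ x) = 0
    · simp [hx]
    · have h1 : nearestRep x₀ x ∈ Metric.ball x₀ δ := by
        rw [Metric.mem_ball]
        exact (hsupp _ hx).trans_le ((min_le_left _ _).trans (by linarith))
      simp only [mul_pow, ← Finset.mul_sum, ← (hball _ h1).2, hp.comp_nearestRep]

/-! ### Taylor expansion at a minimizer -/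

/-- Differentiation under the integral sign replaces `F` by its derivative and `w τ` by `w τ * τ`;
the arbitrary weight and target space let the induction absorb both changes. -/
theorem contDiff_integral_segment {E : Type} [NormedAddCommGroup E] [NormedSpace ℝ E]
    [FiniteDimensional ℝ E] (n : ℕ) {G : Type} [NormedAddCommGroup G] [NormedSpace ℝ G]
    [CompleteSpace G] {F : E → G} (hF : ContDiff ℝ n F) {w : ℝ → ℝ} (hw : Continuous w) (x₀ : E) :
    ContDiff ℝ n fun x => ∫ τ in (0 : ℝ)..1, w τ • F (x₀ + τ • (x - x₀)) := by
  induction n generalizing G w with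
  | zero =>
    rw [Nat.cast_zero, contDiff_zero] at hF ⊢
    refine intervalIntegral.continuous_parametric_intervalIntegral_of_continuous' ?_ 0 1
    simp only [Function.uncurry_def]
    fun_prop
  | succ n ih =>
    have hF1 : ContDiff ℝ 1 F := hF.of_le (by norm_cast; omega)
    have hFd : ContDiff ℝ n (fderiv ℝ F) := hF.fderiv_right (by norm_cast)
    have hFc := hF.continuous
    have hFdc := hFd.continuous
    have hder : ∀ x, HasFDerivAt (fun x => ∫ τ in (0 : ℝ)..1, w τ • F (x₀ + τ • (x - x₀)))
        (∫ τ in (0 : ℝ)..1, (w τ * τ) • fderiv ℝ F (x₀ + τ • (x - x₀))) x := by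
      intro x
      have hc : Continuous fun p : E × ℝ =>
          ‖(w p.2 * p.2) • fderiv ℝ F (x₀ + p.2 • (p.1 - x₀))‖ := by fun_prop
      have : ProperSpace E := FiniteDimensional.proper ℝ E
      have : SecondCountableTopologyEither ℝ (E →L[ℝ] G) :=
        secondCountableTopologyEither_of_left ℝ _
      obtain ⟨B, hB⟩ := ((isCompact_closedBall x 1).prod (isCompact_Icc (a := (0 : ℝ))
        (b := 1))).bddAbove_image hc.continuousOn
      refine (intervalIntegral.hasFDerivAt_integral_of_dominated_of_fderiv_le
        (F := fun x τ => w τ • F (x₀ + τ • (x - x₀)))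
        (F' := fun x τ => (w τ * τ) • fderiv ℝ F (x₀ + τ • (x - x₀)))
        (bound := fun _ => B) (s := Metric.ball x 1) (Metric.ball_mem_nhds x one_pos) ?_ ?_ ?_ ?_ ?_ ?_)
      · refine Eventually.of_forall fun y => Continuous.aestronglyMeasurable ?_
        fun_prop
      · refine Continuous.intervalIntegrable ?_ _ _
        fun_prop
      · refine Continuous.aestronglyMeasurable ?_
        fun_prop
      · refine Eventually.of_forall fun τ hτ y hy => hB ⟨(y, τ), ⟨?_, ?_⟩, rfl⟩
        · exact Metric.ball_subset_closedBall hy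
        · rw [Set.uIoc_of_le zero_le_one] at hτ
          exact ⟨hτ.1.le, hτ.2⟩
      · exact intervalIntegrable_const
      · refine Eventually.of_forall fun τ _ y _ => ?_
        have h1 : HasFDerivAt (fun y => x₀ + τ • (y - x₀)) (τ • ContinuousLinearMap.id ℝ E) y :=
          (((hasFDerivAt_id y).sub_const x₀).const_smul τ).const_add x₀
        have h2 := ((hF1.differentiable one_ne_zero _).hasFDerivAt.comp y h1).const_smul (w τ)
        convert! h2 using 1
        ext v
        simp [mul_smul]
    rw [Nat.cast_add, Nat.cast_one, contDiff_succ_iff_fderiv]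
    refine ⟨fun x => (hder x).differentiableAt, by simp, ?_⟩
    rw [funext fun x => (hder x).fderiv]
    exact ih hFd (hw.mul continuous_id)

theorem taylor_two_integral {E : Type} [NormedAddCommGroup E] [NormedSpace ℝ E] {h : E → ℝ}
    (hh : ContDiff ℝ 2 h) (x₀ x : E) :
    h x = h x₀ + fderiv ℝ h x₀ (x - x₀) +
      (∫ τ in (0 : ℝ)..1, (1 - τ) • fderiv ℝ (fderiv ℝ h) (x₀ + τ • (x - x₀)))
        (x - x₀) (x - x₀) := by
  have hd1 : ContDiff ℝ 1 (fderiv ℝ h) := hh.fderiv_right (by norm_num)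
  have hd2 : Continuous (fderiv ℝ (fderiv ℝ h)) := hd1.continuous_fderiv one_ne_zero
  set v := x - x₀
  have hγ : ∀ τ : ℝ, HasDerivAt (fun τ : ℝ => x₀ + τ • v) v τ := fun τ => by
    simpa using ((hasDerivAt_id τ).smul_const v).const_add x₀
  have h1 : ∀ τ : ℝ, HasDerivAt (fun τ : ℝ => h (x₀ + τ • v)) (fderiv ℝ h (x₀ + τ • v) v) τ :=
    fun τ => (hh.differentiable two_ne_zero _).hasFDerivAt.comp_hasDerivAt τ (hγ τ)
  have h2 : ∀ τ : ℝ, HasDerivAt (fun τ : ℝ => fderiv ℝ h (x₀ + τ • v) v)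
      (fderiv ℝ (fderiv ℝ h) (x₀ + τ • v) v v) τ := fun τ => by
    have := (hd1.differentiable one_ne_zero _).hasFDerivAt.comp_hasDerivAt τ (hγ τ)
    exact this.clm_apply (hasDerivAt_const τ v) |>.congr_deriv (by simp)
  -- For `φ τ = h (x₀ + τ v)`, the function `(1 - τ) φ' + φ` has derivative `(1 - τ) φ''`, so the
  -- fundamental theorem of calculus yields the remainder at once.
  have h3 : ∀ τ : ℝ, HasDerivAt
      (fun τ : ℝ => (1 - τ) * fderiv ℝ h (x₀ + τ • v) v + h (x₀ + τ • v))
      ((1 - τ) * fderiv ℝ (fderiv ℝ h) (x₀ + τ • v) v v) τ := fun τ => by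
    refine ((((hasDerivAt_id τ).const_sub 1).mul (h2 τ)).add (h1 τ)).congr_deriv ?_
    simp
  have hc : Continuous fun τ : ℝ => (1 - τ) • fderiv ℝ (fderiv ℝ h) (x₀ + τ • v) := by fun_prop
  have hc' : Continuous fun τ : ℝ => (1 - τ) * fderiv ℝ (fderiv ℝ h) (x₀ + τ • v) v v := by
    fun_prop
  have h4 := intervalIntegral.integral_eq_sub_of_hasDerivAt (a := 0) (b := 1) (fun τ _ => h3 τ)
    (hc'.intervalIntegrable 0 1)
  rw [ContinuousLinearMap.intervalIntegral_apply (hc.intervalIntegrable 0 1),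
    ContinuousLinearMap.intervalIntegral_apply
      (Continuous.intervalIntegrable (by fun_prop) 0 1)]
  simp only [smul_apply, smul_eq_mul]
  rw [h4]
  simp [v]
  ring

/-! ### Positive definite forms and local sums of squares -/

theorem exists_mul_sum_sq_le {d : ℕ} (P : (Fin d → ℝ) →L[ℝ] (Fin d → ℝ) →L[ℝ] ℝ)
    (hP : ∀ v, v ≠ 0 → 0 < P v v) : ∃ η : ℝ, 0 < η ∧ ∀ v, d * η * ∑ i, v i ^ 2 ≤ P v v := by
  have hcont : Continuous fun v => P v v := by fun_prop
  obtain ⟨μ, hμ, h1⟩ : ∃ μ : ℝ, 0 < μ ∧ ∀ v ∈ Metric.sphere (0 : Fin d → ℝ) 1, μ ≤ P v v := by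
    obtain hS | hS := (Metric.sphere (0 : Fin d → ℝ) 1).eq_empty_or_nonempty
    · exact ⟨1, one_pos, by simp [hS]⟩
    · obtain ⟨v, hv, hmin⟩ := (isCompact_sphere (0 : Fin d → ℝ) 1).exists_isMinOn hS
        hcont.continuousOn
      refine ⟨P v v, hP v ?_, fun u hu => hmin hu⟩
      rintro rfl
      simp at hv
  have h2 : ∀ v, μ * ‖v‖ ^ 2 ≤ P v v := by
    intro v
    by_cases hv : v = 0
    · simp [hv]
    · have hn : 0 < ‖v‖ := norm_pos_iff.2 hv
      have := h1 (‖v‖⁻¹ • v) (by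
        rw [mem_sphere_zero_iff_norm, norm_smul, norm_inv, norm_norm, inv_mul_cancel₀ hn.ne'])
      simp only [map_smul, smul_apply, smul_eq_mul] at this
      rw [← mul_assoc, ← mul_inv, ← sq, inv_mul_eq_div, le_div_iff₀ (by positivity)] at this
      exact this
  -- The norm is the sup norm, so `∑ v i ^ 2 ≤ d ‖v‖²`, and `d² / (d² + 1) ≤ 1`; the `+ 1` covers `d
  -- = 0`.
  refine ⟨μ / (d ^ 2 + 1), by positivity, fun v => le_trans ?_ (h2 v)⟩
  have h3 : ∑ i, v i ^ 2 ≤ d * ‖v‖ ^ 2 := by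
    calc ∑ i, v i ^ 2 ≤ ∑ _i : Fin d, ‖v‖ ^ 2 := by
          refine Finset.sum_le_sum fun i _ => ?_
          rw [← sq_abs, ← Real.norm_eq_abs]
          exact pow_le_pow_left₀ (norm_nonneg _) (norm_le_pi_norm v i) 2
      _ = _ := by simp
  calc d * (μ / (d ^ 2 + 1)) * ∑ i, v i ^ 2 ≤ d * (μ / (d ^ 2 + 1)) * (d * ‖v‖ ^ 2) := by gcongr
    _ = μ * ‖v‖ ^ 2 * (d ^ 2 / (d ^ 2 + 1)) := by ring
    _ ≤ μ * ‖v‖ ^ 2 * 1 := by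
        gcongr
        rw [div_le_one (by positivity)]
        linarith
    _ = _ := mul_one _

theorem bilin_apply_eq_sum {d : ℕ} (P : (Fin d → ℝ) →L[ℝ] (Fin d → ℝ) →L[ℝ] ℝ)
    (v : Fin d → ℝ) :
    P v v = ∑ i, ∑ j, P (Pi.single i 1) (Pi.single j 1) * (v i * v j) := by
  have hv : v = ∑ i, v i • (Pi.single i 1 : Fin d → ℝ) := pi_eq_sum_univ' v
  conv_lhs => rw [hv]
  simp only [map_sum, map_smul, sum_apply, smul_apply, smul_eq_mul, Finset.mul_sum]
  rw [Finset.sum_comm]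
  refine Finset.sum_congr rfl fun i _ => Finset.sum_congr rfl fun j _ => ?_
  ring

/-- A positive definite form minus a small multiple of the identity is a sum of squares of linear
forms. -/
theorem exists_sum_sq_add {d : ℕ} (P : (Fin d → ℝ) →L[ℝ] (Fin d → ℝ) →L[ℝ] ℝ)
    (hsymm : ∀ u v, P u v = P v u) (hP : ∀ v, v ≠ 0 → 0 < P v v) :
    ∃ (η : ℝ) (B : Matrix (Fin d) (Fin d) ℝ), 0 < η ∧
      ∀ v, P v v = ∑ l, (B.mulVec v l) ^ 2 + d * η * ∑ i, v i ^ 2 := by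
  obtain ⟨η, hη, hle⟩ := exists_mul_sum_sq_le P hP
  let M : Matrix (Fin d) (Fin d) ℝ :=
    Matrix.of (fun i j => P (Pi.single i 1) (Pi.single j 1)) - (d * η) • 1
  have hM : ∀ v, v ⬝ᵥ M.mulVec v = P v v - d * η * ∑ i, v i ^ 2 := by
    intro v
    simp only [M, Matrix.sub_mulVec, Matrix.smul_mulVec, Matrix.one_mulVec, dotProduct_sub,
      dotProduct_smul, smul_eq_mul]
    congr 1
    · rw [bilin_apply_eq_sum]
      simp only [dotProduct, Matrix.mulVec, Matrix.of_apply, Finset.mul_sum]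
      refine Finset.sum_congr rfl fun i _ => Finset.sum_congr rfl fun j _ => ?_
      ring
    · simp only [dotProduct, sq]
  have hpsd : M.PosSemidef := by
    refine Matrix.PosSemidef.of_dotProduct_mulVec_nonneg ?_ fun v => ?_
    · ext i j
      simp [M, Matrix.conjTranspose_apply, hsymm (Pi.single j 1), Matrix.one_apply, eq_comm]
    · rw [star_trivial, hM]
      linarith [hle v]
  obtain ⟨B, hB⟩ := exists_eq_conjTranspose_mul_self hpsd
  refine ⟨η, B, hη, fun v => ?_⟩
  have h1 : v ⬝ᵥ M.mulVec v = ∑ l, (B.mulVec v l) ^ 2 := by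
    rw [hB, Matrix.conjTranspose_eq_transpose_of_trivial, ← Matrix.mulVec_mulVec,
      Matrix.dotProduct_mulVec, Matrix.vecMul_transpose]
    simp only [dotProduct, sq]
  rw [← h1, hM]
  ring

/-- No smooth matrix square root is needed. With `y = x - x₀`, `Q x₀` is a sum of squares of linear
forms plus a reserve `d η |y|² = ∑_{i,j} (η/2)(y_i² + y_j²)`. Each perturbation `e_{ij} y_i y_j` is
absorbed by its share of the reserve, as `(η + e)/4 (y_i + y_j)² + (η - e)/4 (y_i - y_j)²`. Near
`x₀` these coefficients are positive, so their roots are `C^s`. -/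
theorem exists_local_sum_sq {d s : ℕ} {h : (Fin d → ℝ) → ℝ} {x₀ : Fin d → ℝ}
    {Q : (Fin d → ℝ) → (Fin d → ℝ) →L[ℝ] (Fin d → ℝ) →L[ℝ] ℝ} (hQ : ContDiff ℝ s Q)
    (hsymm : ∀ u v, Q x₀ u v = Q x₀ v u) (hpos : ∀ v, v ≠ 0 → 0 < Q x₀ v v)
    (hh : ∀ x, h x = Q x (x - x₀) (x - x₀)) :
    ∃ (ι : Type) (_ : Fintype ι) (g : ι → (Fin d → ℝ) → ℝ),
      ∀ᶠ x in 𝓝 x₀, (∀ a, ContDiffAt ℝ s (g a) x) ∧ h x = ∑ a, g a x ^ 2 := by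
  obtain ⟨η, B, hη, hB⟩ := exists_sum_sq_add (Q x₀) hsymm hpos
  let e : Fin d × Fin d → (Fin d → ℝ) → ℝ := fun p x =>
    (Q x - Q x₀) (Pi.single p.1 1) (Pi.single p.2 1)
  have he : ∀ p, ContDiff ℝ s (e p) := fun p =>
    ((hQ.sub contDiff_const).clm_apply contDiff_const).clm_apply contDiff_const
  have hc : ∀ i, ContDiff ℝ s fun x : Fin d → ℝ => x i - x₀ i := fun i =>
    (contDiff_apply ℝ ℝ i).sub contDiff_const
  refine ⟨Fin d ⊕ ((Fin d × Fin d) ⊕ (Fin d × Fin d)), inferInstance, Sum.elim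
    (fun l x => B.mulVec (x - x₀) l) (Sum.elim
    (fun p x => Real.sqrt ((η + e p x) / 4) * ((x p.1 - x₀ p.1) + (x p.2 - x₀ p.2)))
    (fun p x => Real.sqrt ((η - e p x) / 4) * ((x p.1 - x₀ p.1) - (x p.2 - x₀ p.2)))), ?_⟩
  have hev : ∀ᶠ x in 𝓝 x₀, ∀ p, |e p x| < η := by
    rw [eventually_all]
    intro p
    have : |e p x₀| < η := by simpa [e] using hη
    exact (he p).continuous.abs.continuousAt.eventually (eventually_lt_nhds this)
  filter_upwards [hev] with x hx
  have hp1 : ∀ p, 0 < (η + e p x) / 4 := fun p => by linarith [(abs_lt.1 (hx p)).1]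
  have hp2 : ∀ p, 0 < (η - e p x) / 4 := fun p => by linarith [(abs_lt.1 (hx p)).2]
  constructor
  · rintro (l | p | p)
    · simp only [Sum.elim_inl, Matrix.mulVec, dotProduct, Pi.sub_apply]
      exact (ContDiff.sum fun i _ => contDiff_const.mul (hc i)).contDiffAt
    · exact ((((contDiff_const.add (he p)).div_const 4).contDiffAt).sqrt (hp1 p).ne').mul
        ((hc p.1).add (hc p.2)).contDiffAt
    · exact ((((contDiff_const.sub (he p)).div_const 4).contDiffAt).sqrt (hp2 p).ne').mul
        ((hc p.1).sub (hc p.2)).contDiffAt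
  · set y := x - x₀
    have h1 : Q x y y = Q x₀ y y + (Q x - Q x₀) y y := by simp
    rw [hh, h1, hB, bilin_apply_eq_sum (Q x - Q x₀)]
    simp only [Fintype.sum_sum_type, Sum.elim_inl, Sum.elim_inr, mul_pow,
      Real.sq_sqrt (hp1 _).le, Real.sq_sqrt (hp2 _).le]
    rw [add_assoc, ← Finset.sum_add_distrib, Fintype.sum_prod_type]
    congr 1
    have h2 : ∀ i j : Fin d, (η + e (i, j) x) / 4 * ((x i - x₀ i) + (x j - x₀ j)) ^ 2 +
        (η - e (i, j) x) / 4 * ((x i - x₀ i) - (x j - x₀ j)) ^ 2 =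
        η / 2 * y i ^ 2 + η / 2 * y j ^ 2 + e (i, j) x * (y i * y j) := by
      intro i j
      simp only [y, Pi.sub_apply]
      ring
    simp only [h2, Finset.sum_add_distrib, ← Finset.mul_sum]
    simp only [Finset.sum_const, Finset.card_univ, Fintype.card_fin, nsmul_eq_mul, ← Finset.mul_sum]
    ring

/-! ### The decomposition of `f - c_*` and the main theorem -/

theorem minimizers_nonempty {d : ℕ} {f : (Fin d → ℝ) → ℝ} (hf : Continuous f) :
    (minimizers f).Nonempty := by
  obtain ⟨x, hx, h⟩ := (isCompact_cube d).exists_sInf_image_eq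
    ⟨0, Set.left_mem_Icc.2 zero_le_one⟩ hf.continuousOn
  exact ⟨x, hx, h.symm⟩

theorem minValue_le {d : ℕ} {f : (Fin d → ℝ) → ℝ} (hf : Continuous f) (hp : IsPeriodic f)
    (x : Fin d → ℝ) : minValue f ≤ f x := by
  have hp' : LatticePeriodic f := hp
  obtain ⟨y, hy, hyx⟩ := hp'.exists_mem_cube x
  rw [← hyx]
  exact csInf_le ((isCompact_cube d).bddBelow_image hf.continuousOn) ⟨y, hy, rfl⟩

/-- The two extra derivatives of `f` are spent on the second derivative in the Taylor remainder. -/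
theorem isPeriodicSOS_sub_minValue {d s : ℕ} {f : (Fin d → ℝ) → ℝ}
    (hf : ContDiff ℝ ((s + 2 : ℕ) : WithTop ℕ∞) f) (hper : IsPeriodic f)
    (hhess : ∀ x ∈ minimizers f, HessianPosDef f x) :
    IsPeriodicSOS s fun x => f x - minValue f := by
  set h : (Fin d → ℝ) → ℝ := fun x => f x - minValue f
  have hh : ContDiff ℝ ((s + 2 : ℕ) : WithTop ℕ∞) h := hf.sub contDiff_const
  have hh2 : ContDiff ℝ 2 h := hh.of_le (by norm_cast; omega)
  have hhp : LatticePeriodic h := fun x k => by simp only [h, hper x k]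
  have h0 : ∀ x, 0 ≤ h x := fun x => sub_nonneg.2 (minValue_le hf.continuous hper x)
  refine isPeriodicSOS_of_local fun x₀ hx₀ => ?_
  obtain hpos | hzero := (h0 x₀).lt_or_eq
  · refine exists_periodic_cutoff hhp (ι := Unit) (g := fun _ x => Real.sqrt (h x)) ?_
    filter_upwards [hh.continuous.continuousAt.eventually (eventually_gt_nhds hpos)] with x hx
    refine ⟨fun _ => ?_, by simp [Real.sq_sqrt (h0 x)]⟩
    exact (hh.of_le (by norm_cast; omega)).contDiffAt.sqrt hx.ne'
  · have hmin : x₀ ∈ minimizers f := ⟨hx₀, sub_eq_zero.1 hzero.symm⟩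
    have hd0 : fderiv ℝ h x₀ = 0 :=
      IsLocalMin.fderiv_eq_zero (Eventually.of_forall fun x => by rw [← hzero]; exact h0 x)
    have hfd : fderiv ℝ h = fderiv ℝ f := by
      ext1 x
      exact fderiv_sub_const _
    let Q : (Fin d → ℝ) → (Fin d → ℝ) →L[ℝ] (Fin d → ℝ) →L[ℝ] ℝ := fun x =>
      ∫ τ in (0 : ℝ)..1, (1 - τ) • fderiv ℝ (fderiv ℝ h) (x₀ + τ • (x - x₀))
    have hD2 : ContDiff ℝ s (fderiv ℝ (fderiv ℝ h)) :=
      ContDiff.fderiv_right (m := s) (n := (s + 1 : ℕ)) (hh.fderiv_right (by norm_cast))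
        (by norm_cast)
    have hQ : ContDiff ℝ s Q :=
      contDiff_integral_segment s hD2 (continuous_const.sub continuous_id) x₀
    -- The factor is `∫ (1 - τ) dτ = 1/2` over `[0, 1]`.
    have hQ0 : Q x₀ = (1 / 2 : ℝ) • fderiv ℝ (fderiv ℝ f) x₀ := by
      simp only [Q, sub_self, smul_zero, add_zero, hfd]
      refine (intervalIntegral.integral_smul_const (fun τ : ℝ => 1 - τ)
        (fderiv ℝ (fderiv ℝ f) x₀)).trans ?_
      congr 1
      rw [intervalIntegral.integral_sub intervalIntegrable_const
        intervalIntegral.intervalIntegrable_id]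
      norm_num
    have hsymm : ∀ u v, Q x₀ u v = Q x₀ v u := by
      intro u v
      have := (hf.contDiffAt (x := x₀)).isSymmSndFDerivAt (by
        simp only [minSmoothness_of_isRCLikeNormedField]
        norm_cast
        omega)
      simp only [hQ0, smul_apply, this u v]
    have hQpos : ∀ v, v ≠ 0 → 0 < Q x₀ v v := by
      intro v hv
      have := hhess x₀ hmin v hv
      rw [iteratedFDeriv_two_apply] at this
      simp only [Matrix.cons_val_zero, Matrix.cons_val_one] at this
      simp only [hQ0, smul_apply, smul_eq_mul]
      positivity
    have hT : ∀ x, h x = Q x (x - x₀) (x - x₀) := by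
      intro x
      have := taylor_two_integral hh2 x₀ x
      rw [← hzero, hd0] at this
      simpa using this
    obtain ⟨ι, _, g, hg⟩ := exists_local_sum_sq hQ hsymm hQpos hT
    exact exists_periodic_cutoff hhp hg

/-- Converts bandwidth to matrix size through `n ≤ (2t + 1)^d ≤ (3t)^d`. -/
theorem card_rpow_le {d t : ℕ} (hd : 1 ≤ d) (ht : 1 ≤ t) {m : ℝ} (hm : 0 < m) :
    (t : ℝ) ^ (-m) ≤ 3 ^ m * (matrixSize d t : ℝ) ^ (-(m / (d : ℝ))) := by
  have ht0 : (0 : ℝ) < t := by exact_mod_cast ht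
  have hd0 : (0 : ℝ) < d := by exact_mod_cast hd
  have hn0 : (0 : ℝ) < matrixSize d t := by
    exact_mod_cast Finset.card_pos.2 ⟨0, zero_mem_freqs d t⟩
  have hn : (matrixSize d t : ℝ) ≤ (3 * t : ℝ) ^ (d : ℝ) := by
    rw [Real.rpow_natCast]
    have : matrixSize d t ≤ (3 * t) ^ d :=
      (card_freqs_le d t).trans (Nat.pow_le_pow_left (by omega) d)
    exact_mod_cast this
  have h1 : ((3 * t : ℝ) ^ (d : ℝ)) ^ (-(m / (d : ℝ))) ≤
      (matrixSize d t : ℝ) ^ (-(m / (d : ℝ))) :=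
    Real.rpow_le_rpow_of_nonpos hn0 hn (by rw [neg_nonpos]; positivity)
  rw [← Real.rpow_mul (by positivity), mul_neg, mul_div_cancel₀ _ hd0.ne',
    Real.mul_rpow (by norm_num) ht0.le] at h1
  calc (t : ℝ) ^ (-m) = 3 ^ m * (3 ^ (-m) * (t : ℝ) ^ (-m)) := by
        rw [← mul_assoc, ← Real.rpow_add (by norm_num), add_neg_cancel, Real.rpow_zero, one_mul]
    _ ≤ _ := by gcongr

end PeriodicSOS

theorem mainTheorem7 (d : ℕ) (hd : 1 ≤ d) (m : ℝ) (hm : 0 < m)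
    (f : (Fin d → ℝ) → ℝ)
    (hf : ContDiff ℝ ((⌈m + (d : ℝ) / 2⌉₊ + 2 : ℕ) : WithTop ℕ∞) f)
    (hper : PeriodicSOS.IsPeriodic f)
    (hfin : (PeriodicSOS.minimizers f).Finite)
    (hhess : ∀ x ∈ PeriodicSOS.minimizers f, PeriodicSOS.HessianPosDef f x) :
    ∃ C C' : ℝ, ∀ t : ℕ,
      IsGreatest (PeriodicSOS.sdpValues f t) (PeriodicSOS.sdpValue f t) ∧
      0 ≤ PeriodicSOS.minValue f - PeriodicSOS.sdpValue f t ∧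
      (1 ≤ t → PeriodicSOS.minValue f - PeriodicSOS.sdpValue f t ≤ C * (t : ℝ) ^ (-m)) ∧
      PeriodicSOS.minValue f - PeriodicSOS.sdpValue f t ≤
        C' * (PeriodicSOS.matrixSize d t : ℝ) ^ (-(m / (d : ℝ))) := by
  open PeriodicSOS in
  have hs : m + (d : ℝ) / 2 ≤ (⌈m + (d : ℝ) / 2⌉₊ : ℕ) := Nat.le_ceil _
  have hfc : Continuous f := hf.continuous
  have hF : fNorm (fun x => (f x : ℂ)) ≠ ⊤ := fNorm_ne_top_of_contDiff hm hs
    (Complex.ofRealCLM.contDiff.comp (hf.of_le (by norm_cast; omega)))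
    (fun x k => by simp only [hper x k])
  have hgr : ∀ t, IsGreatest (sdpValues f t) (sdpValue f t) := by
    intro t
    obtain ⟨v, hv⟩ := exists_isGreatest_sdpValues hfc hF t
    rwa [sdpValue, hv.csSup_eq]
  obtain ⟨x₀, hx₀⟩ := minimizers_nonempty hfc
  obtain ⟨ι, _, g, hg, hgp, hfg⟩ := isPeriodicSOS_sub_minValue hf hper hhess
  obtain ⟨C, hC0, hC⟩ := exists_posSemidef_fNorm_residual_le hm hs hg hgp hfg
  have hrate : ∀ t : ℕ, 1 ≤ t → minValue f - sdpValue f t ≤ C * (t : ℝ) ^ (-m) := by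
    intro t ht
    obtain ⟨A, hA, hAle⟩ := hC t ht
    -- The pair `(c_*, A)` competes in the maximum, so the gap is at most its residual norm.
    have h1 := (hgr t).2 ⟨minValue f, A, hA, ne_top_of_le_ne_top ENNReal.ofReal_ne_top hAle, rfl⟩
    have h2 := ENNReal.toReal_le_of_le_ofReal (by positivity) hAle
    linarith
  -- At `t = 0` the matrix size is `1`, so the second entry of the maximum is the gap itself; `3^m`
  -- is the cost of passing from `t` to `n`.
  refine ⟨C, max (C * 3 ^ m) (minValue f - sdpValue f 0), fun t => ⟨hgr t,
    sub_nonneg.2 (le_minValue_of_mem_sdpValues hfc hper hx₀ (hgr t).1), hrate t, ?_⟩⟩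
  obtain rfl | ht := Nat.eq_zero_or_pos t
  · have : matrixSize d 0 = 1 := by
      refine le_antisymm ?_ (Finset.card_pos.2 ⟨0, zero_mem_freqs d 0⟩)
      exact (card_freqs_le d 0).trans_eq (by simp)
    rw [this, Nat.cast_one, Real.one_rpow, mul_one]
    exact le_max_right _ _
  · calc minValue f - sdpValue f t ≤ C * (t : ℝ) ^ (-m) := hrate t ht
      _ ≤ C * (3 ^ m * (matrixSize d t : ℝ) ^ (-(m / (d : ℝ)))) := by
          gcongr
          exact card_rpow_le hd ht hm
      _ ≤ _ := by
          rw [← mul_assoc]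
          gcongr
          exact le_max_left _ _
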